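/- Let $d,L\in\mathbb N$ and let $0=t_0<t_1<\dots<t_L=T$ be a time grid. Let $s_\theta:\mathbb R^d\times\mathbb R\to\mathbb R^d$, and consider the reverse-time chain $\bar X_{t_L}\sim\mathcal N(0,I)$, $$\bar X_{t_{l-1}}\mid \bar X_{t_l}=x\ \sim\ \mathcal N\bigl(\mu_{t_l}(x),\sigma_{t_l}^2I\bigr),\qquad \mu_{t_l}(x)=a_l\,x+b_l\,s_\theta(x,t_l),\qquad 1\le l\le L,$$ with real coefficients satisfying $|a_l|,|b_l|\le B$, with $\sigma_{t_l}\ge0$, and with transition density $\phi_\theta(y\mid x)$ whenever $\sigma_{t_l}>0$. Let $P_{\theta,t_l}$ be the law of $\bar X_{t_l}$. Let $\mathcal E=\{(\bar X_0,U)\in A\}$, where $A$ is a measurable set and $U$ is an auxiliary random variable independent of the chain, and put $$h(x,t_l)=\mathbb P(\mathcal E\mid \bar X_{t_l}=x),\qquad P^h_{\theta,t_l}=\mathrm{Law}(\bar X_{t_l}\mid\mathcal E)\quad\Bigl(\text{which has density } \tfrac{h(\cdot,t_l)}{\mathbb P(\mathcal E)}\text{ with respect to }P_{\theta,t_l}\Bigr).$$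 Assume $\mathbb P(\mathcal E)\ge\rho$ with $\rho\in(0,1]$ and that, for every $l\in\{1,\dots,L\}$, $s_\theta(\cdot,t_l)$ is differentiable with $\sup_x\|\nabla_xs_\theta(x,t_l)\|_2\le G$, $G>0$. Fix $l\in\{1,\dots,L\}$ with $\sigma_{t_l}>0$. Let $z^{(m)}_j$ ($1\le m\le M$, $1\le j\le l$) be i.i.d. $\mathcal N(0,I)$ vectors and, for each $x\in\mathbb R^d$, let $x^{(m)}_{t_l}=x$ and $x^{(m)}_{t_{j-1}}=\mu_{t_j}(x^{(m)}_{t_j})+\sigma_{t_j}z^{(m)}_j$ for $j=l,\dots,1$ (so the same noises are used for every $x$). Define $$\hat h(x,t_l)=\frac1M\sum_{m=1}^M h(x_0^{(m)},0),\qquad \nabla\hat h(x,t_l)=\frac1M\sum_{m=1}^M h(x_0^{(m)},0)\,\nabla_x\log\phi_\theta(x^{(m)}_{t_{l-1}}\mid x),$$ (in the latter, $\phi_\theta(y\mid x)$ is differentiated in $x$ with $y$ held fixed at $x^{(m)}_{t_{l-1}}$), and, with the truncation level $\eta_{t_l}=M^{-1/6}$, $$\nabla\log\hat h(x,t_l)=\frac{\nabla\hat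 h(x,t_l)}{\hat h(x,t_l)\vee\eta_{t_l}} .$$ Then for every $\delta_0\in(0,1)$ there are constants $C>0$ and $M_0\ge 1$, depending only on $d,\rho,G,B$ and $\delta_0$, such that for all such models, all such $l$, all $\delta\in(0,\delta_0]$ and all $M\ge M_0$, with probability at least $1-\delta$ over the noises $z^{(m)}_j$, $$\mathbb E_{X\sim P^h_{\theta,t_l}}\Bigl[\bigl\|\nabla\log\hat h(X,t_l)-\nabla\log h(X,t_l)\bigr\|_2^2\Bigr]\ \le\ C\,\frac1{\sigma_{t_l}^2}\,\frac{\log\frac M\delta\,\sqrt{\log(1/\delta)}}{M^{1/6}} .$$ -/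

import Mathlib

open MeasureTheory ProbabilityTheory

noncomputable section

/-- The state space `ℝ^d` with its Euclidean norm. -/
abbrev Vec (d : ℕ) : Type := EuclideanSpace ℝ (Fin d)

/-- A pre-trained diffusion sampler on `ℝ^d` with `L` reverse steps: a time grid
`0 = t 0 < t 1 < ⋯ < t L = T`, a score network `score x t`, and the schedule of Gaussian reverse
steps from time `t l` to time `t (l - 1)`, for `1 ≤ l ≤ L`, with mean
`a l • x + b l • score x (t l)` and covariance `(σ l)² I`.

The exact one-step solution of `dX = [-X/2 - score(X_{t_l}, t_l)] dt + dW̄` is the case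
`a l = exp (Δ/2)`, `b l = 2 (exp (Δ/2) - 1)`, `(σ l)² = exp Δ - 1` with `Δ = t l - t (l - 1)`;
DDIM and Euler ancestral sampling are further choices of the coefficients. -/
structure DiffusionSampler (d L : ℕ) where
  t : ℕ → ℝ
  t_zero : t 0 = 0
  t_lt : ∀ l, l < L → t l < t (l + 1)
  score : Vec d → ℝ → Vec d
  a : ℕ → ℝ
  b : ℕ → ℝ
  σ : ℕ → ℝ
  σ_nonneg : ∀ l, 0 ≤ σ l

namespace DiffusionSampler

variable {d L : ℕ} (S : DiffusionSampler d L)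

/-- The mean `μ_{t_l}(x, s_θ)` of the reverse step from `t_l` to `t_{l-1}`. -/
def mean (l : ℕ) (x : Vec d) : Vec d := S.a l • x + S.b l • S.score x (S.t l)

/-- The reverse step from `t_l` to `t_{l-1}`, driven by a standard Gaussian vector `z`:
the result has law `N(μ_{t_l}(x, s_θ), σ_{t_l}² I)`. -/
def step (l : ℕ) (x z : Vec d) : Vec d := S.mean l x + S.σ l • z

/-- The Gaussian transition density `φ_θ(y | x)` of the reverse step from `x` at time `t_l` to `y`
at time `t_{l-1}`. -/
def transitionDensity (l : ℕ) (x y : Vec d) : ℝ :=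
  (2 * Real.pi * S.σ l ^ 2) ^ (-(d : ℝ) / 2) *
    Real.exp (-‖y - S.mean l x‖ ^ 2 / (2 * S.σ l ^ 2))

/-- The time-`0` state of the reverse trajectory started from `x` at time `t_l` and driven by the
noises `z_l, z_{l-1}, …, z_1`; the noise of the step from `t_j` to `t_{j-1}` is the entry of `z`
with (zero-based) index `j - 1`. -/
def rollout : (l : ℕ) → Vec d → (Fin l → Vec d) → Vec d
  | 0, x, _ => x
  | l + 1, x, z => rollout l (S.step (l + 1) x (z (Fin.last l))) (Fin.init z)

/-- The law of the generated process after `n` reverse steps, started from `N(0, I)` at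
time `t_L`. -/
def lawAfter : ℕ → Measure (Vec d)
  | 0 => stdGaussian (Vec d)
  | n + 1 => ((lawAfter n).prod (stdGaussian (Vec d))).map fun p => S.step (L - n) p.1 p.2

/-- The marginal law `P_{θ, t_l}` of the generated process at time `t_l`, for `l ≤ L`. -/
def marginal (l : ℕ) : Measure (Vec d) := S.lawAfter (L - l)

end DiffusionSampler

/-- The law of the i.i.d. standard Gaussian noises driving one trajectory of `l` reverse steps. -/
def noiseLaw (d l : ℕ) : Measure (Fin l → Vec d) :=
  Measure.pi fun _ => stdGaussian (Vec d)

/-- The law of the noises driving `M` independent trajectories of `l` reverse steps. -/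
def mcLaw (d l M : ℕ) : Measure (Fin M → Fin l → Vec d) :=
  Measure.pi fun _ => noiseLaw d l

namespace DiffusionSampler

variable {d L : ℕ} (S : DiffusionSampler d L)

/- The conditioning event is given by a set `A ⊆ ℝ^d × 𝒰`: it occurs when `(X̄_0, U) ∈ A`, where `U`
is an auxiliary randomisation with law `ν`, independent of the trajectory. -/
variable {𝒰 : Type*} [MeasurableSpace 𝒰] (ν : Measure 𝒰) (A : Set (Vec d × 𝒰))

/-- The probability of the conditioning event under the generated distribution. -/
def eventProb : ℝ := ((S.marginal 0).prod ν).real A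

/-- Doob's `h`-function `h(x, t_l)`: the probability of the conditioning event when the reverse
process is at `x` at time `t_l`. -/
def doobH (l : ℕ) (x : Vec d) : ℝ :=
  ((noiseLaw d l).prod ν).real {p | (S.rollout l x p.1, p.2) ∈ A}

/-- The law `P^h_{θ, t_l}`: the conditional law of the state at time `t_l` given the conditioning
event. The state at time `t_l`, the later noises and `U` are independent. -/
def tiltedMarginal (l : ℕ) : Measure (Vec d) :=
  (cond ((S.marginal l).prod ((noiseLaw d l).prod ν))
    {p | (S.rollout l p.1 p.2.1, p.2.2) ∈ A}).map Prod.fst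

/-- The Monte Carlo estimator `ĥ(x, t_l)` from `M` rollouts started at `x`. -/
def hHat (l M : ℕ) (z : Fin M → Fin l → Vec d) (x : Vec d) : ℝ :=
  (1 / (M : ℝ)) * ∑ m, S.doobH ν A 0 (S.rollout l x (z m))

/-- The Monte Carlo estimator `∇ĥ(x, t_l)` of the gradient, at `l = k + 1 ≥ 1`: the average of
`h(x_0, 0) ∇_x log φ_θ(y | x)`, with `x_0` the end and `y` the first new state of the rollout. -/
def gradHHat (k M : ℕ) (z : Fin M → Fin (k + 1) → Vec d) (x : Vec d) : Vec d :=
  (1 / (M : ℝ)) • ∑ m, S.doobH ν A 0 (S.rollout (k + 1) x (z m)) •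
    gradient (fun x' => Real.log
      (S.transitionDensity (k + 1) x' (S.step (k + 1) x (z m (Fin.last k))))) x

/-- The truncated plug-in estimator `∇ĥ / (ĥ ∨ η)` of `∇ log h(x, t_l)`, at `l = k + 1 ≥ 1`. -/
def gradLogHHat (k M : ℕ) (η : ℝ) (z : Fin M → Fin (k + 1) → Vec d) (x : Vec d) : Vec d :=
  (max (S.hHat ν A (k + 1) M z x) η)⁻¹ • S.gradHHat ν A k M z x

/-- The mean-squared error of the estimator under `P^h_{θ, t_l}`, at `l = k + 1 ≥ 1`, as a function
of the Monte Carlo noises `z`. -/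
def mse (k M : ℕ) (η : ℝ) (z : Fin M → Fin (k + 1) → Vec d) : ENNReal :=
  ∫⁻ x, ‖S.gradLogHHat ν A k M η z x
      - gradient (fun x' => Real.log (S.doobH ν A (k + 1) x')) x‖ₑ ^ 2
    ∂(S.tiltedMarginal ν A (k + 1))

/-- The conditioning event has probability at least `ρ`, and at every grid time `t_1, …, t_L` the
score is differentiable in `x` with Jacobian of spectral norm at most `G`. -/
structure Regular (ρ G : ℝ) : Prop where
  eventProb_ge : ρ ≤ S.eventProb ν A
  score_differentiable : ∀ l, 1 ≤ l → l ≤ L → Differentiable ℝ fun x => S.score x (S.t l)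
  score_fderiv_le : ∀ l, 1 ≤ l → l ≤ L → ∀ x, ‖fderiv ℝ (fun x' => S.score x' (S.t l)) x‖ ≤ G

/-- The coefficients of the means of the reverse steps are bounded by `B`. -/
def CoeffBounded (B : ℝ) : Prop :=
  ∀ l, 1 ≤ l → l ≤ L → |S.a l| ≤ B ∧ |S.b l| ≤ B

end DiffusionSampler

end

/-! ### Sub-Gaussian concentration for sums of independent vectors -/

section Concentration

open scoped RealInnerProductSpace

/-! Write `l = k + 1`, let `Z` be standard Gaussian, `J` the Jacobian of the mean `μ` at `x`, `h =
h(x, t_l)` and `V = 𝔼[h(μ(x) + σZ, t_k) Z]`. Putting the derivative on the Gaussian density gives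
`∇h = σ⁻¹ Jᵀ V`, and the estimator is `σ⁻¹ Jᵀ V̂` with `V̂` an unbiased average for `V`. As `‖J‖ ≤ B
+ B G`, it remains to compare `V̂ / (ĥ ∨ η)` with `V / h` in mean square under the tilted law.

Entropy bound (`exists_norm_integral_smul_sq_le`): a weight in `[0,1]` of Gaussian mean `h`
satisfies `‖V‖² ≤ h² (a log(1/h) + b)`. Hence `V / (h ∨ η)` is of size at most `√R` with `R = a
log(1/η) + a + b`, and the error splits into a Monte Carlo part of order `(1 + R) η⁻² (‖V̂ - V‖² +
(ĥ - h)²)` and a bias on `{h < η}` (`norm_truncated_ratio_sub_sq_le`). The tilted law has density `h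
/ ℙ(ℰ)`, and this factor `h` makes the bias at most of order `R η / ρ`.

Concentration (`exists_lintegral_exp_estimator_error_le`): at each fixed `x`, `exp(κ M (‖V̂ - V‖² +
(ĥ - h)²))` has expectation at most `D`, with `κ, D` depending on `d` only. Averaging this
exponential over `x`, then using Markov and Jensen (`measure_lintegral_le_log_ge`), bounds the
integrated Monte Carlo error by `log(D/δ) / (κ M)` with probability `1 - δ`; no covering of the
state space is needed. With `η = M^(-1/6)` the bias is the dominant term (`rate_bound`). -/

theorem exp_le_add_exp_sq (x : ℝ) : Real.exp x ≤ x + Real.exp (x ^ 2) := by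
  have h1 := Real.add_one_le_exp (x ^ 2)
  rcases le_or_gt |x| 1 with hx | hx
  · have := (abs_le.1 (Real.abs_exp_sub_one_sub_id_le hx)).2
    linarith
  · rcases lt_abs.1 hx with hx | hx
    · have : Real.exp x ≤ Real.exp (x ^ 2) := Real.exp_le_exp.2 (by nlinarith)
      linarith
    · have : Real.exp x ≤ 1 := Real.exp_le_one_iff.2 (by linarith)
      nlinarith

theorem exp_mul_le_of_mem_Icc {s : ℝ} (hs : 0 ≤ s) (hs1 : s ≤ 1) (w : ℝ) :
    Real.exp (s * w) ≤ 1 - s + s * Real.exp w := by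
  have := convexOn_exp.2 (Set.mem_univ (0 : ℝ)) (Set.mem_univ w) (sub_nonneg.2 hs1) hs (by ring)
  simpa using this

variable {Ω : Type*} [MeasurableSpace Ω] {P : Measure Ω} [IsProbabilityMeasure P]
  {E : Type*} [NormedAddCommGroup E] [InnerProductSpace ℝ E]

theorem inner_le_sq_div_add {c : ℝ} (hc : 0 < c) (y u : E) :
    ⟪y, u⟫ ≤ ‖u‖ ^ 2 / (4 * c) + c * ‖y‖ ^ 2 := by
  have h1 := real_inner_le_norm y u
  have h2 : 0 ≤ (‖u‖ - 2 * c * ‖y‖) ^ 2 / (4 * c) := by positivity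
  have h3 : (‖u‖ - 2 * c * ‖y‖) ^ 2 / (4 * c)
      = ‖u‖ ^ 2 / (4 * c) - ‖y‖ * ‖u‖ + c * ‖y‖ ^ 2 := by
    field_simp; ring
  linarith

omit [InnerProductSpace ℝ E] in
theorem integrable_of_integrable_exp_sq {Y : Ω → E} (hY : AEStronglyMeasurable Y P) {c : ℝ}
    (hc : 0 < c) (hint : Integrable (fun ω => Real.exp (c * ‖Y ω‖ ^ 2)) P) : Integrable Y P := by
  refine ((integrable_const (1 / (4 * c))).add hint).mono' hY (ae_of_all _ fun ω => ?_)
  have h1 := Real.add_one_le_exp (c * ‖Y ω‖ ^ 2)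
  have h2 : 0 ≤ (1 - 2 * c * ‖Y ω‖) ^ 2 / (4 * c) := by positivity
  have h3 : (1 - 2 * c * ‖Y ω‖) ^ 2 / (4 * c) = 1 / (4 * c) - ‖Y ω‖ + c * ‖Y ω‖ ^ 2 := by
    field_simp; ring
  simp only [Pi.add_apply]
  linarith

omit [IsProbabilityMeasure P] in
theorem integrable_exp_inner {Y : Ω → E} (hY : AEStronglyMeasurable Y P) {c : ℝ}
    (hc : 0 < c) (hint : Integrable (fun ω => Real.exp (c * ‖Y ω‖ ^ 2)) P) (u : E) :
    Integrable (fun ω => Real.exp ⟪Y ω, u⟫) P := by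
  refine (hint.const_mul (Real.exp (‖u‖ ^ 2 / (4 * c)))).mono'
    (Real.continuous_exp.comp_aestronglyMeasurable
      (hY.inner aestronglyMeasurable_const)) (ae_of_all _ fun ω => ?_)
  rw [Real.norm_eq_abs, Real.abs_exp, ← Real.exp_add]
  exact Real.exp_le_exp.2 (inner_le_sq_div_add hc _ _)

/-- A centred random vector with a finite square-exponential moment is sub-Gaussian. -/
theorem integral_exp_inner_le [CompleteSpace E] {Y : Ω → E} (hY : AEStronglyMeasurable Y P)
    {c D : ℝ} (hc : 0 < c) (hint : Integrable (fun ω => Real.exp (c * ‖Y ω‖ ^ 2)) P)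
    (hD : ∫ ω, Real.exp (c * ‖Y ω‖ ^ 2) ∂P ≤ D) (h0 : ∫ ω, Y ω ∂P = 0) (u : E) :
    ∫ ω, Real.exp ⟪Y ω, u⟫ ∂P ≤ Real.exp (D / c * ‖u‖ ^ 2) := by
  have hYint := integrable_of_integrable_exp_sq hY hc hint
  have hexp := integrable_exp_inner hY hc hint u
  have hD1 : 1 ≤ D := by
    refine le_trans ?_ hD
    have : ∫ _ω, (1 : ℝ) ∂P ≤ ∫ ω, Real.exp (c * ‖Y ω‖ ^ 2) ∂P :=
      integral_mono (integrable_const _) hint fun ω => Real.one_le_exp (by positivity)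
    simpa using this
  -- For small `u` the linear term vanishes by centring, and convexity interpolates `exp(s c‖Y‖²)`
  -- between `1` and `exp(c‖Y‖²)`. For large `u` Young's inequality suffices without centring: its
  -- prefactor `D ≤ exp(D - 1)` is absorbed because `‖u‖² / c ≥ 1`.
  rcases le_or_gt (‖u‖ ^ 2) c with hu | hu
  · set s := ‖u‖ ^ 2 / c with hs
    have hs0 : 0 ≤ s := by positivity
    have hs1 : s ≤ 1 := (div_le_one hc).2 hu
    have hin : Integrable (fun ω => ⟪Y ω, u⟫) P := hYint.inner_const u
    have hzero : ∫ ω, ⟪Y ω, u⟫ ∂P = 0 := by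
      simp_rw [fun ω => real_inner_comm u (Y ω)]
      rw [integral_inner hYint u, h0, inner_zero_right]
    calc ∫ ω, Real.exp ⟪Y ω, u⟫ ∂P
        ≤ ∫ ω, (⟪Y ω, u⟫ + ((1 - s) + s * Real.exp (c * ‖Y ω‖ ^ 2))) ∂P := by
          refine integral_mono hexp (hin.add ((integrable_const _).add (hint.const_mul s)))
            fun ω => ?_
          refine (exp_le_add_exp_sq _).trans ?_
          have hle : ⟪Y ω, u⟫ ^ 2 ≤ s * (c * ‖Y ω‖ ^ 2) := by
            have : s * (c * ‖Y ω‖ ^ 2) = (‖Y ω‖ * ‖u‖) ^ 2 := by rw [hs]; field_simp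
            rw [this]
            exact sq_le_sq' (neg_le_of_abs_le (abs_real_inner_le_norm _ _))
              (real_inner_le_norm _ _)
          have := exp_mul_le_of_mem_Icc hs0 hs1 (c * ‖Y ω‖ ^ 2)
          have := Real.exp_le_exp.2 hle
          linarith
      _ = (1 - s) + s * ∫ ω, Real.exp (c * ‖Y ω‖ ^ 2) ∂P := by
          have h2 := hint.const_mul s
          have h1 : Integrable (fun ω => (1 - s) + s * Real.exp (c * ‖Y ω‖ ^ 2)) P :=
            (integrable_const _).add h2
          rw [integral_add hin h1, hzero, integral_add (integrable_const _) h2,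
            integral_const_mul]
          simp
      _ ≤ s * D + 1 := by nlinarith
      _ ≤ Real.exp (s * D) := Real.add_one_le_exp _
      _ = Real.exp (D / c * ‖u‖ ^ 2) := by rw [hs]; congr 1; ring
  · calc ∫ ω, Real.exp ⟪Y ω, u⟫ ∂P
        ≤ ∫ ω, Real.exp (‖u‖ ^ 2 / (4 * c)) * Real.exp (c * ‖Y ω‖ ^ 2) ∂P := by
          refine integral_mono hexp (hint.const_mul _) fun ω => ?_
          simp only
          rw [← Real.exp_add]
          exact Real.exp_le_exp.2 (inner_le_sq_div_add hc _ _)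
      _ ≤ Real.exp (‖u‖ ^ 2 / (4 * c)) * D := by
          rw [integral_const_mul]; gcongr
      _ ≤ Real.exp (‖u‖ ^ 2 / (4 * c)) * Real.exp (D - 1) := by
          gcongr; have := Real.add_one_le_exp (D - 1); linarith
      _ ≤ Real.exp (D / c * ‖u‖ ^ 2) := by
          rw [← Real.exp_add]
          refine Real.exp_le_exp.2 ?_
          have h1 : (D - 1) * 1 ≤ (D - 1) * (‖u‖ ^ 2 / c) :=
            mul_le_mul_of_nonneg_left ((one_le_div hc).2 hu.le) (by linarith)
          have h2 : ‖u‖ ^ 2 / (4 * c) ≤ ‖u‖ ^ 2 / c := by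
            apply div_le_div_of_nonneg_left <;> first | positivity | linarith
          have h3 : D / c * ‖u‖ ^ 2 = (D - 1) * (‖u‖ ^ 2 / c) + ‖u‖ ^ 2 / c := by ring
          linarith

/-- Moment generating function of a sum of independent copies. -/
theorem lintegral_exp_inner_sum_le [CompleteSpace E] {Y : Ω → E} (hY : AEStronglyMeasurable Y P)
    {c D : ℝ} (hc : 0 < c) (hint : Integrable (fun ω => Real.exp (c * ‖Y ω‖ ^ 2)) P)
    (hD : ∫ ω, Real.exp (c * ‖Y ω‖ ^ 2) ∂P ≤ D) (h0 : ∫ ω, Y ω ∂P = 0) (n : ℕ) (u : E) :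
    ∫⁻ z, ENNReal.ofReal (Real.exp ⟪∑ m, Y (z m), u⟫) ∂(Measure.pi fun _ : Fin n => P)
      ≤ ENNReal.ofReal (Real.exp (n * (D / c * ‖u‖ ^ 2))) := by
  have hprod : ∀ z : Fin n → Ω,
      Real.exp ⟪∑ m, Y (z m), u⟫ = ∏ m, Real.exp ⟪Y (z m), u⟫ := fun z => by
    rw [sum_inner, Real.exp_sum]
  have hI := Integrable.fintype_prod (ι := Fin n) (μ := fun _ => P)
    (f := fun _ ω => Real.exp ⟪Y ω, u⟫) fun _ => integrable_exp_inner hY hc hint u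
  simp_rw [hprod]
  rw [← ofReal_integral_eq_lintegral_ofReal hI (ae_of_all _ fun z => by positivity),
    integral_fintype_prod_eq_pow (fun ω => Real.exp ⟪Y ω, u⟫), Fintype.card_fin, Real.exp_nat_mul]
  exact ENNReal.ofReal_le_ofReal (pow_le_pow_left₀ (integral_nonneg fun _ => by positivity)
    (integral_exp_inner_le hY hc hint hD h0 u) n)

section FiniteDimensional

variable [FiniteDimensional ℝ E] [MeasurableSpace E] [BorelSpace E]

theorem integrable_exp_inner_stdGaussian (v : E) :
    Integrable (fun z => Real.exp ⟪v, z⟫) (stdGaussian E) := by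
  obtain ⟨c, hc, hint⟩ := IsGaussian.exists_integrable_exp_sq (stdGaussian E)
  simp_rw [fun z => real_inner_comm z v]
  exact integrable_exp_inner (Y := fun z => z) aestronglyMeasurable_id hc hint v

theorem integral_exp_inner_stdGaussian (v : E) :
    ∫ z, Real.exp ⟪v, z⟫ ∂(stdGaussian E) = Real.exp (‖v‖ ^ 2 / 2) := by
  have h := IsGaussian.map_eq_gaussianReal (μ := stdGaussian E) (innerSL ℝ v)
  rw [variance_dual_stdGaussian, integral_strongDual_stdGaussian] at h
  have := mgf_gaussianReal h 1
  simpa [mgf] using this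

theorem lintegral_exp_mul_inner_stdGaussian (v : E) (τ : ℝ) :
    ∫⁻ u, ENNReal.ofReal (Real.exp ⟪v, τ • u⟫) ∂(stdGaussian E)
      = ENNReal.ofReal (Real.exp (τ ^ 2 * ‖v‖ ^ 2 / 2)) := by
  have hv : ∀ u : E, ⟪v, τ • u⟫ = ⟪τ • v, u⟫ := fun u => by
    rw [real_inner_smul_left, real_inner_smul_right]
  simp_rw [hv]
  rw [← ofReal_integral_eq_lintegral_ofReal (integrable_exp_inner_stdGaussian _)
    (ae_of_all _ fun z => by positivity), integral_exp_inner_stdGaussian, norm_smul, mul_pow,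
    Real.norm_eq_abs, sq_abs]

variable (E) in
/-- Square-exponential moments of normalised sums of independent centred random vectors, uniformly
over all laws with a given square-exponential moment bound. -/
theorem exists_lintegral_exp_sq_sum_le {c D : ℝ} (hc : 0 < c) (hDpos : 0 < D) :
    ∃ κ D' : ℝ, 0 < κ ∧ 0 < D' ∧ ∀ {Ω : Type} [MeasurableSpace Ω] (P : Measure Ω)
      [IsProbabilityMeasure P] (Y : Ω → E), Measurable Y →
      Integrable (fun ω => Real.exp (c * ‖Y ω‖ ^ 2)) P →
      ∫ ω, Real.exp (c * ‖Y ω‖ ^ 2) ∂P ≤ D → ∫ ω, Y ω ∂P = 0 → ∀ n : ℕ, 0 < n →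
      ∫⁻ z, ENNReal.ofReal (Real.exp (κ * (‖∑ m, Y (z m)‖ ^ 2 / n)))
        ∂(Measure.pi fun _ : Fin n => P) ≤ ENNReal.ofReal D' := by
  obtain ⟨a, ha, hint⟩ := IsGaussian.exists_integrable_exp_sq (stdGaussian E)
  -- The square is linearised by an auxiliary Gaussian `u`: `exp(τ²‖v‖²/2) = 𝔼 exp⟪v, τu⟫`. After
  -- exchanging integrals the sum contributes at most `exp(n (D/c) τ²‖u‖²)`. The choice `τ² =
  -- ac/(Dn)` turns this into `exp(a‖u‖²)`, integrable by Fernique's theorem, and gives `κ = n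
  -- τ²/2`.
  refine ⟨a * c / (2 * D), ∫ u, Real.exp (a * ‖u‖ ^ 2) ∂(stdGaussian E), by positivity,
    integral_exp_pos hint, ?_⟩
  intro Ω _ P _ Y hY hYint hYD hY0 n hn
  have hn' : (0 : ℝ) < n := by exact_mod_cast hn
  set τ := √(a * c / (D * n)) with hτ
  have hτ2 : τ ^ 2 = a * c / (D * n) := Real.sq_sqrt (by positivity)
  have hmeas : Measurable fun p : (Fin n → Ω) × E =>
      ENNReal.ofReal (Real.exp ⟪∑ m, Y (p.1 m), τ • p.2⟫) := by fun_prop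
  calc ∫⁻ z, ENNReal.ofReal (Real.exp (a * c / (2 * D) * (‖∑ m, Y (z m)‖ ^ 2 / n)))
        ∂(Measure.pi fun _ : Fin n => P)
      = ∫⁻ z, ∫⁻ u, ENNReal.ofReal (Real.exp ⟪∑ m, Y (z m), τ • u⟫) ∂(stdGaussian E)
        ∂(Measure.pi fun _ : Fin n => P) := by
        refine lintegral_congr fun z => ?_
        rw [lintegral_exp_mul_inner_stdGaussian, hτ2]
        congr 2
        field_simp
    _ = ∫⁻ u, ∫⁻ z, ENNReal.ofReal (Real.exp ⟪∑ m, Y (z m), τ • u⟫)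
        ∂(Measure.pi fun _ : Fin n => P) ∂(stdGaussian E) :=
        lintegral_lintegral_swap hmeas.aemeasurable
    _ ≤ ∫⁻ u, ENNReal.ofReal (Real.exp (a * ‖u‖ ^ 2)) ∂(stdGaussian E) := by
        refine lintegral_mono fun u => ?_
        refine (lintegral_exp_inner_sum_le hY.aestronglyMeasurable hc hYint hYD hY0 n _).trans ?_
        refine ENNReal.ofReal_le_ofReal (le_of_eq ?_)
        rw [norm_smul, mul_pow, Real.norm_eq_abs, sq_abs, hτ2]
        congr 1
        field_simp
    _ = ENNReal.ofReal (∫ u, Real.exp (a * ‖u‖ ^ 2) ∂(stdGaussian E)) :=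
        (ofReal_integral_eq_lintegral_ofReal hint (ae_of_all _ fun z => by positivity)).symm

end FiniteDimensional

/-- Chernoff's bound for an average `∫ W x ω dT(x)` of nonnegative random variables. -/
theorem measure_lintegral_le_log_ge {X : Type*} [MeasurableSpace X] (T : Measure X)
    [IsProbabilityMeasure T] {W : X → Ω → ℝ} (hW : Measurable (Function.uncurry W))
    (hW0 : ∀ x ω, 0 ≤ W x ω) {D δ : ℝ} (hD : 0 < D) (hδ : 0 < δ)
    (hexp : ∀ x, ∫⁻ ω, ENNReal.ofReal (Real.exp (W x ω)) ∂P ≤ ENNReal.ofReal D) :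
    ENNReal.ofReal (1 - δ) ≤
      P {ω | ∫⁻ x, ENNReal.ofReal (W x ω) ∂T ≤ ENNReal.ofReal (Real.log (D / δ))} := by
  -- Markov's inequality is applied to the `T`-average of the exponentials, so a single event serves
  -- all `x`; Jensen's inequality then takes the exponential outside the average.
  set F : Ω → ENNReal := fun ω => ∫⁻ x, ENNReal.ofReal (Real.exp (W x ω)) ∂T with hF
  have hW' : Measurable (Function.uncurry fun ω x => W x ω) := hW.comp measurable_swap
  have hmeas : Measurable (Function.uncurry fun ω x => ENNReal.ofReal (Real.exp (W x ω))) :=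
    ENNReal.measurable_ofReal.comp (Real.measurable_exp.comp hW')
  have hFm : Measurable F := hmeas.lintegral_prod_right'
  have hFint : ∫⁻ ω, F ω ∂P ≤ ENNReal.ofReal D := by
    rw [hF, lintegral_lintegral_swap hmeas.aemeasurable]
    calc _ ≤ ∫⁻ _x, ENNReal.ofReal D ∂T := lintegral_mono hexp
      _ = _ := by simp
  have hmarkov : P {ω | ENNReal.ofReal (D / δ) ≤ F ω} ≤ ENNReal.ofReal δ := by
    refine (meas_ge_le_lintegral_div hFm.aemeasurable (by simpa using by positivity)
      ENNReal.ofReal_ne_top).trans ?_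
    refine (ENNReal.div_le_div_right hFint _).trans (le_of_eq ?_)
    rw [← ENNReal.ofReal_div_of_pos (by positivity)]
    congr 1
    field_simp
  have hcompl : {ω | ENNReal.ofReal (D / δ) ≤ F ω}ᶜ ⊆
      {ω | ∫⁻ x, ENNReal.ofReal (W x ω) ∂T ≤ ENNReal.ofReal (Real.log (D / δ))} := by
    intro ω hω
    have hω' : F ω < ENNReal.ofReal (D / δ) := not_le.1 hω
    have hWω : Measurable fun x => W x ω := hW.comp (measurable_id.prodMk measurable_const)
    have hexpint : Integrable (fun x => Real.exp (W x ω)) T := by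
      refine ⟨(Real.measurable_exp.comp hWω).aestronglyMeasurable, ?_⟩
      rw [hasFiniteIntegral_iff_ofReal (ae_of_all _ fun x => by positivity)]
      exact hω'.trans ENNReal.ofReal_lt_top
    have hWint : Integrable (fun x => W x ω) T := by
      refine hexpint.mono' hWω.aestronglyMeasurable (ae_of_all _ fun x => ?_)
      rw [Real.norm_of_nonneg (hW0 x ω)]
      have := Real.add_one_le_exp (W x ω)
      linarith
    have hjensen : Real.exp (∫ x, W x ω ∂T) ≤ ∫ x, Real.exp (W x ω) ∂T :=
      convexOn_exp.map_integral_le Real.continuous_exp.continuousOn isClosed_univ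
        (ae_of_all _ fun _ => Set.mem_univ _) hWint hexpint
    have hlt : ∫ x, Real.exp (W x ω) ∂T < D / δ := by
      rw [← ENNReal.ofReal_lt_ofReal_iff (by positivity),
        ofReal_integral_eq_lintegral_ofReal hexpint (ae_of_all _ fun x => by positivity)]
      exact hω'
    rw [Set.mem_ofPred_eq,
      ← ofReal_integral_eq_lintegral_ofReal hWint (ae_of_all _ fun x => hW0 x ω)]
    refine ENNReal.ofReal_le_ofReal ?_
    rw [Real.le_log_iff_exp_le (by positivity)]
    exact hjensen.trans hlt.le
  calc ENNReal.ofReal (1 - δ) = 1 - ENNReal.ofReal δ := by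
        rw [ENNReal.ofReal_sub _ hδ.le, ENNReal.ofReal_one]
    _ ≤ 1 - P {ω | ENNReal.ofReal (D / δ) ≤ F ω} := tsub_le_tsub_left hmarkov _
    _ = P {ω | ENNReal.ofReal (D / δ) ≤ F ω}ᶜ :=
        (prob_compl_eq_one_sub (measurableSet_le measurable_const hFm)).symm
    _ ≤ _ := measure_mono hcompl

end Concentration

/-! ### Gaussian shifts and differentiation of Gaussian averages -/

section GaussianSmoothing

open scoped RealInnerProductSpace

variable {E : Type*} [NormedAddCommGroup E] [InnerProductSpace ℝ E] [FiniteDimensional ℝ E]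
  [MeasurableSpace E] [BorelSpace E]

/-- The integrand factorises along an orthonormal basis into one-dimensional complex moment
generating functions. A real and an imaginary exponent occur together because the Cameron–Martin
formula is checked on characteristic functions. -/
theorem integral_cexp_inner_stdGaussian (v t : E) :
    ∫ x, Complex.exp ((⟪x, v⟫ : ℝ) + (⟪x, t⟫ : ℝ) * Complex.I) ∂(stdGaussian E)
      = Complex.exp (((‖v‖ ^ 2 : ℝ) - (‖t‖ ^ 2 : ℝ)) / 2 + (⟪v, t⟫ : ℝ) * Complex.I) := by
  set b := stdOrthonormalBasis ℝ E with hb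
  set w : Fin (Module.finrank ℝ E) → ℂ := fun i =>
    (⟪b i, v⟫ : ℝ) + (⟪b i, t⟫ : ℝ) * Complex.I with hw
  have hsplit : ∀ x : Fin (Module.finrank ℝ E) → ℝ,
      Complex.exp ((⟪∑ i, x i • b i, v⟫ : ℝ) + (⟪∑ i, x i • b i, t⟫ : ℝ) * Complex.I)
        = ∏ i, Complex.exp (w i * (x i : ℂ)) := fun x => by
    rw [← Complex.exp_sum]
    congr 1
    simp only [sum_inner, real_inner_smul_left, Complex.ofReal_sum, Complex.ofReal_mul,
      Finset.sum_mul, ← Finset.sum_add_distrib, hw]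
    exact Finset.sum_congr rfl fun i _ => by ring
  have hone : ∀ i, ∫ x : ℝ, Complex.exp (w i * (x : ℂ)) ∂(gaussianReal 0 1)
      = Complex.exp (w i ^ 2 / 2) := fun i => by
    have := complexMGF_id_gaussianReal (μ := 0) (v := 1) (w i)
    simpa [complexMGF] using this
  rw [stdGaussian, integral_map (Measurable.aemeasurable (by fun_prop))
    (Measurable.aestronglyMeasurable (by fun_prop))]
  simp_rw [← hb, hsplit]
  rw [integral_fintype_prod_eq_prod (f := fun i (x : ℝ) => Complex.exp (w i * (x : ℂ)))]
  simp_rw [hone, ← Complex.exp_sum]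
  congr 1
  have h1 := b.sum_sq_inner_right v
  have h2 := b.sum_sq_inner_right t
  have h3 : ∑ i, ⟪b i, v⟫ * ⟪b i, t⟫ = ⟪v, t⟫ := by
    rw [← b.sum_inner_mul_inner v t]
    exact Finset.sum_congr rfl fun i _ => by rw [real_inner_comm v]
  rw [← h1, ← h2, ← h3]
  push_cast
  rw [← Finset.sum_sub_distrib, Finset.sum_div, Finset.sum_mul, ← Finset.sum_add_distrib]
  refine Finset.sum_congr rfl fun i _ => ?_
  rw [hw]
  linear_combination (⟪b i, t⟫ : ℂ) ^ 2 / 2 * Complex.I_sq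

/-- The Cameron–Martin formula for the standard Gaussian measure. -/
theorem map_add_const_stdGaussian (v : E) :
    (stdGaussian E).map (fun z => z + v) =
      (stdGaussian E).withDensity fun z =>
        ENNReal.ofReal (Real.exp (⟪v, z⟫ - ‖v‖ ^ 2 / 2)) := by
  have hmeas : Measurable fun z : E => Real.exp (⟪v, z⟫ - ‖v‖ ^ 2 / 2) := by fun_prop
  have hint : Integrable (fun z : E => Real.exp (⟪v, z⟫ - ‖v‖ ^ 2 / 2)) (stdGaussian E) := by
    simp_rw [Real.exp_sub]
    exact (integrable_exp_inner_stdGaussian v).div_const _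
  have : IsFiniteMeasure ((stdGaussian E).withDensity fun z =>
      ENNReal.ofReal (Real.exp (⟪v, z⟫ - ‖v‖ ^ 2 / 2))) :=
    isFiniteMeasure_withDensity_ofReal hint.2
  have : IsProbabilityMeasure ((stdGaussian E).map (fun z => z + v)) :=
    Measure.isProbabilityMeasure_map (by fun_prop)
  refine Measure.ext_of_charFun (funext fun t => ?_)
  rw [charFun_apply, charFun_apply, integral_map (by fun_prop)
      (Measurable.aestronglyMeasurable (by fun_prop)),
    integral_withDensity_eq_integral_toReal_smul hmeas.ennreal_ofReal
      (ae_of_all _ fun _ => ENNReal.ofReal_lt_top)]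
  have h1 : ∀ z : E, Complex.exp ((⟪z + v, t⟫ : ℝ) * Complex.I)
      = Complex.exp ((⟪v, t⟫ : ℝ) * Complex.I) *
        Complex.exp ((⟪z, (0 : E)⟫ : ℝ) + (⟪z, t⟫ : ℝ) * Complex.I) := fun z => by
    rw [← Complex.exp_add, inner_add_left, inner_zero_right]
    congr 1
    push_cast
    ring
  have h2 : ∀ z : E, (ENNReal.ofReal (Real.exp (⟪v, z⟫ - ‖v‖ ^ 2 / 2))).toReal •
      Complex.exp ((⟪z, t⟫ : ℝ) * Complex.I)
      = Complex.exp (-(‖v‖ ^ 2 : ℝ) / 2) *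
        Complex.exp ((⟪z, v⟫ : ℝ) + (⟪z, t⟫ : ℝ) * Complex.I) := fun z => by
    rw [ENNReal.toReal_ofReal (Real.exp_pos _).le, Complex.real_smul, Complex.ofReal_exp,
      ← Complex.exp_add, ← Complex.exp_add, real_inner_comm]
    congr 1
    push_cast
    ring
  simp_rw [h1, h2, integral_const_mul, integral_cexp_inner_stdGaussian, ← Complex.exp_add]
  congr 1
  simp
  ring

theorem integral_add_const_stdGaussian {g : E → ℝ} (hg : Measurable g) (v : E) :
    ∫ z, g (z + v) ∂(stdGaussian E)
      = ∫ z, Real.exp (⟪v, z⟫ - ‖v‖ ^ 2 / 2) * g z ∂(stdGaussian E) := by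
  have hmeas : Measurable fun z : E => Real.exp (⟪v, z⟫ - ‖v‖ ^ 2 / 2) := by fun_prop
  rw [← integral_map (φ := fun z => z + v) (f := g) (by fun_prop) hg.aestronglyMeasurable,
    map_add_const_stdGaussian, integral_withDensity_eq_integral_toReal_smul
      hmeas.ennreal_ofReal (ae_of_all _ fun _ => ENNReal.ofReal_lt_top)]
  simp_rw [ENNReal.toReal_ofReal (Real.exp_pos _).le, smul_eq_mul]

variable (E) in
theorem integrable_exp_mul_norm_stdGaussian (r : ℝ) :
    Integrable (fun z => Real.exp (r * ‖z‖)) (stdGaussian E) := by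
  obtain ⟨c, hc, hint⟩ := IsGaussian.exists_integrable_exp_sq (stdGaussian E)
  refine (hint.const_mul (Real.exp (r ^ 2 / (4 * c)))).mono'
    (Continuous.aestronglyMeasurable (by fun_prop)) (ae_of_all _ fun z => ?_)
  rw [Real.norm_eq_abs, Real.abs_exp, ← Real.exp_add]
  refine Real.exp_le_exp.2 ?_
  have h2 : 0 ≤ (r - 2 * c * ‖z‖) ^ 2 / (4 * c) := by positivity
  have h3 : (r - 2 * c * ‖z‖) ^ 2 / (4 * c) = r ^ 2 / (4 * c) - r * ‖z‖ + c * ‖z‖ ^ 2 := by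
    field_simp; ring
  linarith

omit [FiniteDimensional ℝ E] [MeasurableSpace E] [BorelSpace E] in
theorem hasFDerivAt_exp_inner_sub (v z : E) :
    HasFDerivAt (fun v => Real.exp (⟪v, z⟫ - ‖v‖ ^ 2 / 2))
      (Real.exp (⟪v, z⟫ - ‖v‖ ^ 2 / 2) • innerSL ℝ (z - v)) v := by
  have h1 : HasFDerivAt (fun v : E => ⟪v, z⟫) (innerSL ℝ z) v := by
    have := (innerSL ℝ z).hasFDerivAt (x := v)
    simpa [real_inner_comm] using this
  have h2 := (hasStrictFDerivAt_norm_sq v).hasFDerivAt.const_mul (1 / 2 : ℝ)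
  have h3 := (h1.sub h2).exp
  have hfun : (fun v : E => Real.exp (⟪v, z⟫ - ‖v‖ ^ 2 / 2)) =
      fun v => Real.exp (⟪v, z⟫ - 1 / 2 * ‖v‖ ^ 2) := by
    funext v
    rw [div_eq_inv_mul, one_div]
  rw [hfun]
  refine h3.congr_fderiv ?_
  ext w
  simp [div_eq_inv_mul]

theorem integrable_smul_id_stdGaussian {g : E → ℝ} (hg : Measurable g)
    (hg1 : ∀ z, |g z| ≤ 1) : Integrable (fun z => g z • z) (stdGaussian E) := by
  refine (IsGaussian.integrable_id (μ := stdGaussian E)).mono (by fun_prop)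
    (ae_of_all _ fun z => ?_)
  rw [norm_smul, Real.norm_eq_abs]
  exact mul_le_of_le_one_left (norm_nonneg _) (hg1 z)

/-- The shift enters only through the smooth density, so `g` needs no regularity. Shift `0` is
enough, since any other centre is reached by translating `g`; on the unit ball of shifts the
derivative is dominated by `exp(2‖z‖)`. -/
theorem hasFDerivAt_integral_exp_inner_sub {g : E → ℝ} (hg : Measurable g)
    (hg1 : ∀ z, |g z| ≤ 1) :
    HasFDerivAt (fun v => ∫ z, Real.exp (⟪v, z⟫ - ‖v‖ ^ 2 / 2) * g z ∂(stdGaussian E))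
      (innerSL ℝ (∫ z, g z • z ∂(stdGaussian E))) 0 := by
  have hzint := integrable_smul_id_stdGaussian hg hg1
  have key := hasFDerivAt_integral_of_dominated_of_fderiv_le (𝕜 := ℝ) (μ := stdGaussian E)
    (F := fun v z => Real.exp (⟪v, z⟫ - ‖v‖ ^ 2 / 2) * g z)
    (F' := fun v z => g z • (Real.exp (⟪v, z⟫ - ‖v‖ ^ 2 / 2) • innerSL ℝ (z - v)))
    (bound := fun z => Real.exp (2 * ‖z‖)) (x₀ := (0 : E)) (Metric.ball_mem_nhds 0 one_pos)
    (Filter.Eventually.of_forall fun v => by fun_prop) ?_ ?_ ?_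
    (integrable_exp_mul_norm_stdGaussian E 2) ?_
  · refine key.congr_fderiv ?_
    rw [← ContinuousLinearMap.integral_comp_comm _ hzint]
    refine integral_congr_ae (ae_of_all _ fun z => ?_)
    ext w
    simp
    exact Or.inl rfl
  · refine (integrable_const (1 : ℝ)).mono' (by fun_prop) (ae_of_all _ fun z => ?_)
    simpa using hg1 z
  · have : (fun z : E => g z • (Real.exp (⟪(0 : E), z⟫ - ‖(0 : E)‖ ^ 2 / 2) • innerSL ℝ (z - 0)))
        = fun z => innerSL ℝ (g z • z) := by funext z; ext w; simp
    rw [this]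
    exact (innerSL ℝ).continuous.comp_aestronglyMeasurable hzint.1
  · refine ae_of_all _ fun z v hv => ?_
    have hv' : ‖v‖ ≤ 1 := by simpa using (Metric.mem_ball.1 hv).le
    rw [norm_smul, norm_smul, innerSL_apply_norm, Real.norm_eq_abs, Real.norm_eq_abs,
      Real.abs_exp]
    have h1 : ⟪v, z⟫ - ‖v‖ ^ 2 / 2 ≤ ‖z‖ := by
      have := real_inner_le_norm v z
      nlinarith [norm_nonneg z, norm_nonneg v]
    have h2 : ‖z - v‖ ≤ Real.exp ‖z‖ := by
      have := norm_sub_le z v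
      have := Real.add_one_le_exp ‖z‖
      linarith
    calc |g z| * (Real.exp (⟪v, z⟫ - ‖v‖ ^ 2 / 2) * ‖z - v‖)
        ≤ 1 * (Real.exp ‖z‖ * Real.exp ‖z‖) := by
          gcongr
          exact hg1 z
      _ = Real.exp (2 * ‖z‖) := by rw [one_mul, ← Real.exp_add, two_mul]
  · exact ae_of_all _ fun z v _ => by
      simpa [mul_comm] using (hasFDerivAt_exp_inner_sub v z).mul_const (g z)

/-- Differentiation of a Gaussian average of a bounded measurable function in its centre. -/
theorem hasFDerivAt_integral_add_smul_stdGaussian {g : E → ℝ} (hg : Measurable g)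
    (hg1 : ∀ z, |g z| ≤ 1) {σ : ℝ} (hσ : 0 < σ) (m : E) :
    HasFDerivAt (fun m => ∫ z, g (m + σ • z) ∂(stdGaussian E))
      (σ⁻¹ • innerSL ℝ (∫ z, g (m + σ • z) • z ∂(stdGaussian E))) m := by
  have hg' : Measurable fun z : E => g (m + σ • z) := by fun_prop
  have h1 := hasFDerivAt_integral_exp_inner_sub hg' fun z => hg1 _
  have h2 : HasFDerivAt (fun m' : E => σ⁻¹ • (m' - m)) (σ⁻¹ • ContinuousLinearMap.id ℝ E) m :=
    ((hasFDerivAt_id m).sub_const m).const_smul σ⁻¹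
  have h3 : HasFDerivAt (fun v => ∫ z, Real.exp (⟪v, z⟫ - ‖v‖ ^ 2 / 2) * g (m + σ • z)
      ∂(stdGaussian E)) (innerSL ℝ (∫ z, g (m + σ • z) • z ∂(stdGaussian E)))
      (σ⁻¹ • (m - m)) := by simpa using h1
  -- Moving the centre from `m` to `m'` shifts the noise by `σ⁻¹(m' - m)`; Cameron–Martin transfers
  -- this shift from `g` to the density.
  have hcomp : (fun m => ∫ z, g (m + σ • z) ∂(stdGaussian E)) = fun m' =>
      ∫ z, Real.exp (⟪σ⁻¹ • (m' - m), z⟫ - ‖σ⁻¹ • (m' - m)‖ ^ 2 / 2) * g (m + σ • z)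
        ∂(stdGaussian E) := by
    funext m'
    rw [← integral_add_const_stdGaussian hg']
    congr 1; funext z
    rw [smul_add, smul_smul, mul_inv_cancel₀ hσ.ne', one_smul]
    congr 1; abel
  rw [hcomp]
  refine (h3.comp m h2).congr_fderiv ?_
  ext w
  simp

end GaussianSmoothing

/-! ### Noise laws -/

section NoiseLaw

instance isProbabilityMeasure_noiseLaw (d l : ℕ) : IsProbabilityMeasure (noiseLaw d l) := by
  unfold noiseLaw; infer_instance

instance isProbabilityMeasure_mcLaw (d l M : ℕ) : IsProbabilityMeasure (mcLaw d l M) := by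
  unfold mcLaw; infer_instance

theorem measurable_finInit {α : Type*} [MeasurableSpace α] (l : ℕ) :
    Measurable fun z : Fin (l + 1) → α => (Fin.init z : Fin l → α) :=
  measurable_pi_lambda _ fun i => measurable_pi_apply i.castSucc

/-- `rollout` consumes the last coordinate first, so this splits off the noise of the earliest
reverse step from the independent noises of the later ones. -/
theorem measurePreserving_last_init (d l : ℕ) :
    MeasurePreserving (fun z : Fin (l + 1) → Vec d => (z (Fin.last l), (Fin.init z : Fin l → Vec d)))
      (noiseLaw d (l + 1)) ((stdGaussian (Vec d)).prod (noiseLaw d l)) := by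
  have h := measurePreserving_piFinSuccAbove (fun _ : Fin (l + 1) => stdGaussian (Vec d))
    (Fin.last l)
  convert h using 2
  · simp [MeasurableEquiv.piFinSuccAbove, Fin.insertNthEquiv]
  all_goals rfl

theorem measurePreserving_last (d l : ℕ) :
    MeasurePreserving (fun z : Fin (l + 1) → Vec d => z (Fin.last l))
      (noiseLaw d (l + 1)) (stdGaussian (Vec d)) :=
  measurePreserving_eval (fun _ : Fin (l + 1) => stdGaussian (Vec d)) (Fin.last l)

end NoiseLaw

/-! ### The reverse chain and its marginals -/

namespace DiffusionSampler

variable {d L : ℕ} {S : DiffusionSampler d L}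

theorem measurable_step (hS : ∀ l, 1 ≤ l → l ≤ L → Measurable fun x => S.score x (S.t l))
    {l : ℕ} (hl : 1 ≤ l) (hlL : l ≤ L) :
    Measurable fun p : Vec d × Vec d => S.step l p.1 p.2 := by
  have := hS l hl hlL
  unfold step mean
  fun_prop

theorem measurable_rollout (hS : ∀ l, 1 ≤ l → l ≤ L → Measurable fun x => S.score x (S.t l))
    {l : ℕ} (hl : l ≤ L) :
    Measurable fun p : Vec d × (Fin l → Vec d) => S.rollout l p.1 p.2 := by
  induction l with
  | zero => exact measurable_fst
  | succ l ih =>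
    have h1 := ih (by omega)
    have h2 := measurable_step hS (l := l + 1) (by omega) hl
    have h3 := measurable_finInit (α := Vec d) l
    exact h1.comp ((h2.comp (measurable_fst.prodMk
      ((measurable_pi_apply (Fin.last l)).comp measurable_snd))).prodMk (h3.comp measurable_snd))

theorem isProbabilityMeasure_lawAfter
    (hS : ∀ l, 1 ≤ l → l ≤ L → Measurable fun x => S.score x (S.t l)) {n : ℕ} (hn : n ≤ L) :
    IsProbabilityMeasure (S.lawAfter n) := by
  induction n with
  | zero => unfold lawAfter; infer_instance
  | succ n ih =>
    have := ih (by omega)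
    exact Measure.isProbabilityMeasure_map
      (measurable_step hS (by omega) (by omega)).aemeasurable

theorem isProbabilityMeasure_marginal
    (hS : ∀ l, 1 ≤ l → l ≤ L → Measurable fun x => S.score x (S.t l)) (l : ℕ) :
    IsProbabilityMeasure (S.marginal l) :=
  isProbabilityMeasure_lawAfter hS (Nat.sub_le L l)

theorem map_step_marginal_succ {l : ℕ} (hl : l + 1 ≤ L) :
    ((S.marginal (l + 1)).prod (stdGaussian (Vec d))).map (fun p => S.step (l + 1) p.1 p.2)
      = S.marginal l := by
  -- `marginal` is indexed by time and `lawAfter` by the number of steps taken from `t_L`; `l + 1 ≤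
  -- L` makes the natural-number subtractions exact.
  have h1 : L - l = (L - (l + 1)) + 1 := by omega
  have h2 : L - (L - (l + 1)) = l + 1 := by omega
  rw [marginal, marginal, h1, lawAfter, h2]

/-- Rolling the chain out from its law at time `t_l` gives its law at time `0`. -/
theorem map_rollout_marginal
    (hS : ∀ l, 1 ≤ l → l ≤ L → Measurable fun x => S.score x (S.t l)) {l : ℕ} (hl : l ≤ L) :
    ((S.marginal l).prod (noiseLaw d l)).map (fun p => S.rollout l p.1 p.2) = S.marginal 0 := by
  induction l with
  | zero =>
    change ((S.marginal 0).prod (noiseLaw d 0)).map Prod.fst = _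
    simp
  | succ l ih =>
    have := isProbabilityMeasure_marginal hS (l + 1)
    have := isProbabilityMeasure_marginal hS l
    have hstep := measurable_step hS (l := l + 1) (by omega) hl
    have hroll := measurable_rollout hS (l := l) (by omega)
    rw [← ih (by omega), ← map_step_marginal_succ hl]
    have hid : (noiseLaw d l).map id = noiseLaw d l := Measure.map_id
    conv_rhs => rw [← hid]
    rw [Measure.map_prod_map _ _ hstep measurable_id, Measure.map_map hroll (by fun_prop)]
    have hmp := (MeasurePreserving.id (S.marginal (l + 1))).prod (measurePreserving_last_init d l)
    have hassoc := measurePreserving_prodAssoc (S.marginal (l + 1)) (stdGaussian (Vec d))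
      (noiseLaw d l)
    rw [← (hassoc.symm _).map_eq, ← hmp.map_eq, Measure.map_map (by fun_prop) hmp.measurable,
      Measure.map_map (by fun_prop) (by fun_prop)]
    rfl


/-! ### Doob's `h`-function and the tilted law -/

section DoobH

variable {𝒰 : Type*} [MeasurableSpace 𝒰] {ν : Measure 𝒰} [IsProbabilityMeasure ν]
  {A : Set (Vec d × 𝒰)}

omit [IsProbabilityMeasure ν] in
theorem doobH_nonneg (l : ℕ) (x : Vec d) : 0 ≤ S.doobH ν A l x := measureReal_nonneg

theorem doobH_le_one (l : ℕ) (x : Vec d) : S.doobH ν A l x ≤ 1 := measureReal_le_one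

theorem abs_doobH_le_one (l : ℕ) (x : Vec d) : |S.doobH ν A l x| ≤ 1 :=
  abs_le.2 ⟨by linarith [S.doobH_nonneg (ν := ν) (A := A) l x], doobH_le_one l x⟩

theorem doobH_zero (x : Vec d) : S.doobH ν A 0 x = ν.real (Prod.mk x ⁻¹' A) := by
  have : {p : (Fin 0 → Vec d) × 𝒰 | (S.rollout 0 x p.1, p.2) ∈ A}
      = Set.univ ×ˢ (Prod.mk x ⁻¹' A) := by
    ext p; simp [rollout]
  rw [doobH, this, measureReal_prod_prod]
  simp

theorem measurable_doobH_zero (hA : MeasurableSet A) : Measurable (S.doobH ν A 0) := by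
  have : S.doobH ν A 0 = fun x => ν.real (Prod.mk x ⁻¹' A) := funext doobH_zero
  rw [this]
  exact (measurable_measure_prodMk_left hA).ennreal_toReal

theorem measurableSet_rollout_mem (hA : MeasurableSet A)
    (hS : ∀ l, 1 ≤ l → l ≤ L → Measurable fun x => S.score x (S.t l)) {l : ℕ} (hl : l ≤ L) :
    MeasurableSet {p : Vec d × ((Fin l → Vec d) × 𝒰) | (S.rollout l p.1 p.2.1, p.2.2) ∈ A} := by
  have h := measurable_rollout hS hl
  have : Measurable fun p : Vec d × ((Fin l → Vec d) × 𝒰) =>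
      (S.rollout l p.1 p.2.1, p.2.2) :=
    (h.comp (measurable_fst.prodMk (measurable_fst.comp measurable_snd))).prodMk
      (measurable_snd.comp measurable_snd)
  exact this hA

theorem measurable_doobH (hA : MeasurableSet A)
    (hS : ∀ l, 1 ≤ l → l ≤ L → Measurable fun x => S.score x (S.t l)) {l : ℕ} (hl : l ≤ L) :
    Measurable (S.doobH ν A l) :=
  (measurable_measure_prodMk_left (measurableSet_rollout_mem hA hS hl)).ennreal_toReal

theorem doobH_eq_integral (hA : MeasurableSet A)
    (hS : ∀ l, 1 ≤ l → l ≤ L → Measurable fun x => S.score x (S.t l)) {l : ℕ} (hl : l ≤ L)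
    (x : Vec d) :
    S.doobH ν A l x = ∫ z, S.doobH ν A 0 (S.rollout l x z) ∂(noiseLaw d l) := by
  have hset := (measurable_prodMk_left (x := x)) (measurableSet_rollout_mem hA hS hl)
  have hroll : Measurable fun z => S.rollout l x z :=
    (measurable_rollout hS hl).comp measurable_prodMk_left
  simp_rw [doobH_zero]
  rw [doobH, measureReal_def]
  simp_rw [measureReal_def]
  have hm : Measurable fun z => ν (Prod.mk (S.rollout l x z) ⁻¹' A) :=
    (measurable_measure_prodMk_left hA).comp hroll
  rw [integral_toReal hm.aemeasurable (ae_of_all _ fun _ => measure_lt_top _ _)]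
  exact congrArg ENNReal.toReal (Measure.prod_apply hset)

/-- Tower property: integrating out all noises after the first step replaces the terminal `h` by its
value at time `t_k`. The case `f = 1` gives the one-step recursion, and `f = id` the unbiasedness of
`weightedNoiseHat`. -/
theorem integral_doobH_rollout_smul_last {F : Type*} [NormedAddCommGroup F] [NormedSpace ℝ F]
    [CompleteSpace F] [SecondCountableTopology F] [MeasurableSpace F] [BorelSpace F]
    (hA : MeasurableSet A)
    (hS : ∀ l, 1 ≤ l → l ≤ L → Measurable fun x => S.score x (S.t l)) {k : ℕ} (hk : k + 1 ≤ L)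
    (x : Vec d) {f : Vec d → F} (hf : Measurable f) (hfint : Integrable f (stdGaussian (Vec d))) :
    ∫ z, S.doobH ν A 0 (S.rollout (k + 1) x z) • f (z (Fin.last k)) ∂(noiseLaw d (k + 1))
      = ∫ w, S.doobH ν A k (S.step (k + 1) x w) • f w ∂(stdGaussian (Vec d)) := by
  have hroll := measurable_rollout hS (l := k) (by omega)
  have hstep := measurable_step hS (l := k + 1) (by omega) hk
  have hmeas : Measurable fun p : Vec d × (Fin k → Vec d) =>
      S.doobH ν A 0 (S.rollout k (S.step (k + 1) x p.1) p.2) :=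
    (measurable_doobH_zero hA).comp (hroll.comp
      ((hstep.comp (measurable_const.prodMk measurable_fst)).prodMk measurable_snd))
  have hint : Integrable (fun p : Vec d × (Fin k → Vec d) =>
      S.doobH ν A 0 (S.rollout k (S.step (k + 1) x p.1) p.2) • f p.1)
      ((stdGaussian (Vec d)).prod (noiseLaw d k)) := by
    have h1 : Integrable (fun p : Vec d × (Fin k → Vec d) => f p.1)
      ((stdGaussian (Vec d)).prod (noiseLaw d k)) := hfint.comp_fst _
    refine h1.mono (hmeas.smul (hf.comp measurable_fst)).aestronglyMeasurable
      (ae_of_all _ fun p => ?_)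
    rw [norm_smul, Real.norm_eq_abs]
    exact mul_le_of_le_one_left (norm_nonneg _) (abs_doobH_le_one _ _)
  have hmp := measurePreserving_last_init d k
  have h := integral_map (μ := noiseLaw d (k + 1)) hmp.measurable.aemeasurable
    (f := fun p : Vec d × (Fin k → Vec d) =>
      S.doobH ν A 0 (S.rollout k (S.step (k + 1) x p.1) p.2) • f p.1)
    (by rw [hmp.map_eq]; exact hint.1)
  rw [hmp.map_eq, integral_prod _ hint] at h
  rw [show (∫ z, S.doobH ν A 0 (S.rollout (k + 1) x z) • f (z (Fin.last k))
    ∂(noiseLaw d (k + 1))) = _ from h.symm]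
  refine integral_congr_ae (ae_of_all _ fun w => ?_)
  simp only
  rw [integral_smul_const, ← doobH_eq_integral hA hS (by omega)]

/-- The one-step recursion of Doob's `h`-function. -/
theorem doobH_succ (hA : MeasurableSet A)
    (hS : ∀ l, 1 ≤ l → l ≤ L → Measurable fun x => S.score x (S.t l)) {k : ℕ} (hk : k + 1 ≤ L)
    (x : Vec d) :
    S.doobH ν A (k + 1) x
      = ∫ w, S.doobH ν A k (S.step (k + 1) x w) ∂(stdGaussian (Vec d)) := by
  have h := integral_doobH_rollout_smul_last hA hS hk x (f := fun _ => (1 : ℝ)) (ν := ν)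
    measurable_const (integrable_const _)
  simpa [← doobH_eq_integral hA hS hk] using h

/-- The normalising constant of the tilted marginal is therefore the same at every time, and the
lower bound `ρ` applies to it. -/
theorem prod_rollout_mem_eq (hA : MeasurableSet A)
    (hS : ∀ l, 1 ≤ l → l ≤ L → Measurable fun x => S.score x (S.t l)) {l : ℕ} (hl : l ≤ L) :
    ((S.marginal l).prod ((noiseLaw d l).prod ν))
      {p | (S.rollout l p.1 p.2.1, p.2.2) ∈ A} = ((S.marginal 0).prod ν) A := by
  have := isProbabilityMeasure_marginal hS l
  have := isProbabilityMeasure_marginal hS 0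
  have hroll := measurable_rollout hS hl
  have hassoc := measurePreserving_prodAssoc (S.marginal l) (noiseLaw d l) ν
  have hmp : MeasurePreserving (fun p : Vec d × (Fin l → Vec d) => S.rollout l p.1 p.2)
      ((S.marginal l).prod (noiseLaw d l)) (S.marginal 0) := ⟨hroll, map_rollout_marginal hS hl⟩
  have hmp' := hmp.prod (MeasurePreserving.id ν)
  rw [← hassoc.measure_preimage (measurableSet_rollout_mem hA hS hl).nullMeasurableSet,
    ← hmp'.measure_preimage hA.nullMeasurableSet]
  rfl

theorem isProbabilityMeasure_tiltedMarginal (hA : MeasurableSet A)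
    (hS : ∀ l, 1 ≤ l → l ≤ L → Measurable fun x => S.score x (S.t l)) {l : ℕ} (hl : l ≤ L)
    (hpos : 0 < S.eventProb ν A) : IsProbabilityMeasure (S.tiltedMarginal ν A l) := by
  have := isProbabilityMeasure_marginal hS l
  have hne : ((S.marginal l).prod ((noiseLaw d l).prod ν))
      {p | (S.rollout l p.1 p.2.1, p.2.2) ∈ A} ≠ 0 := by
    rw [prod_rollout_mem_eq hA hS hl]
    intro h0
    rw [eventProb, measureReal_def, h0] at hpos
    simp at hpos
  have := cond_isProbabilityMeasure hne
  exact Measure.isProbabilityMeasure_map measurable_fst.aemeasurable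

/-- Integration against the tilted marginal, whose density with respect to the marginal is
`h / ℙ(ℰ)`. -/
theorem lintegral_tiltedMarginal_le (hA : MeasurableSet A)
    (hS : ∀ l, 1 ≤ l → l ≤ L → Measurable fun x => S.score x (S.t l)) {l : ℕ} (hl : l ≤ L)
    {ρ : ℝ} (hρ : 0 < ρ) (hev : ρ ≤ S.eventProb ν A) {f : Vec d → ℝ} (hf : Measurable f)
    {c : ℝ} (hfc : ∀ x, S.doobH ν A l x * f x ≤ c) :
    ∫⁻ x, ENNReal.ofReal (f x) ∂(S.tiltedMarginal ν A l) ≤ ENNReal.ofReal (c / ρ) := by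
  have := isProbabilityMeasure_marginal hS l
  have := isProbabilityMeasure_marginal hS 0
  have hset := measurableSet_rollout_mem hA hS hl
  set E := {p : Vec d × ((Fin l → Vec d) × 𝒰) | (S.rollout l p.1 p.2.1, p.2.2) ∈ A} with hE
  have hE' : ENNReal.ofReal ρ ≤ ((S.marginal l).prod ((noiseLaw d l).prod ν)) E := by
    rw [prod_rollout_mem_eq hA hS hl]
    exact (ENNReal.ofReal_le_ofReal hev).trans_eq (ofReal_measureReal (measure_ne_top _ _))
  have hfst : Measurable fun p : Vec d × ((Fin l → Vec d) × 𝒰) => ENNReal.ofReal (f p.1) :=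
    (hf.comp measurable_fst).ennreal_ofReal
  rw [tiltedMarginal, lintegral_map hf.ennreal_ofReal measurable_fst, ProbabilityTheory.cond,
    lintegral_smul_measure, smul_eq_mul, ← lintegral_indicator hset,
    lintegral_prod _ (hfst.indicator hset).aemeasurable]
  -- The section of the event over `x` has mass `h(x)`, so integrating out the noises and `U`
  -- produces the factor `h` bounded jointly with `f`.
  have hinner : ∀ x, ∫⁻ y, E.indicator (fun p => ENNReal.ofReal (f p.1)) (x, y)
      ∂((noiseLaw d l).prod ν) ≤ ENNReal.ofReal c := fun x => by
    have hx : ∀ y, E.indicator (fun p => ENNReal.ofReal (f p.1)) (x, y)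
        = (Prod.mk x ⁻¹' E).indicator (fun _ => ENNReal.ofReal (f x)) y := fun y => by
      by_cases hy : (x, y) ∈ E <;> simp [Set.indicator, hy]
    simp_rw [hx]
    rw [lintegral_indicator_const (measurable_prodMk_left hset),
      ← ofReal_measureReal (measure_ne_top _ _), mul_comm,
      ← ENNReal.ofReal_mul measureReal_nonneg]
    exact ENNReal.ofReal_le_ofReal (hfc x)
  calc _ ≤ (ENNReal.ofReal ρ)⁻¹ * ENNReal.ofReal c := by
        refine mul_le_mul' (ENNReal.inv_le_inv.2 hE') ((lintegral_mono hinner).trans ?_)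
        simp
    _ = ENNReal.ofReal (c / ρ) := by
        rw [← ENNReal.ofReal_inv_of_pos hρ, ← ENNReal.ofReal_mul (by positivity),
          div_eq_inv_mul]

/-- Doob's `h`-function is almost surely positive under the tilted marginal. -/
theorem ae_doobH_pos (hA : MeasurableSet A)
    (hS : ∀ l, 1 ≤ l → l ≤ L → Measurable fun x => S.score x (S.t l)) {l : ℕ} (hl : l ≤ L)
    {ρ : ℝ} (hρ : 0 < ρ) (hev : ρ ≤ S.eventProb ν A) :
    ∀ᵐ x ∂(S.tiltedMarginal ν A l), 0 < S.doobH ν A l x := by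
  have hm := measurable_doobH (ν := ν) hA hS hl
  have hs : MeasurableSet {x | S.doobH ν A l x = 0} := hm (measurableSet_singleton 0)
  have h := lintegral_tiltedMarginal_le hA hS hl hρ hev
    (f := {x | S.doobH ν A l x = 0}.indicator fun _ => 1) (measurable_const.indicator hs) (c := 0)
    fun x => by
      by_cases hx : S.doobH ν A l x = 0 <;> simp [hx]
  have h1 : ∀ x, ENNReal.ofReal ({x | S.doobH ν A l x = 0}.indicator (fun _ => (1 : ℝ)) x)
      = {x | S.doobH ν A l x = 0}.indicator (fun _ => (1 : ENNReal)) x := fun x => by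
    by_cases hx : S.doobH ν A l x = 0 <;> simp [hx]
  simp_rw [h1] at h
  rw [lintegral_indicator_const hs, one_mul, zero_div, ENNReal.ofReal_zero, nonpos_iff_eq_zero]
    at h
  refine measure_mono_null (fun x hx => ?_) h
  exact le_antisymm (not_lt.1 hx) (doobH_nonneg l x)

end DoobH

end DiffusionSampler

/-! ### The entropy bound -/

open scoped RealInnerProductSpace in
/-- The Gaussian mean of a `[0,1]`-weighted vector is controlled by the entropy of the weight. -/
theorem exists_norm_integral_smul_sq_le (d : ℕ) : ∃ a b : ℝ, 0 ≤ a ∧ 0 ≤ b ∧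
    ∀ g : Vec d → ℝ, Measurable g → (∀ z, 0 ≤ g z) → (∀ z, g z ≤ 1) →
      0 < ∫ z, g z ∂(stdGaussian (Vec d)) →
      ‖∫ z, g z • z ∂(stdGaussian (Vec d))‖ ^ 2 ≤ (∫ z, g z ∂(stdGaussian (Vec d))) ^ 2 *
        (a * -Real.log (∫ z, g z ∂(stdGaussian (Vec d))) + b) := by
  obtain ⟨c, hc, hexp⟩ := IsGaussian.exists_integrable_exp_sq (stdGaussian (Vec d))
  have hD0 : 0 ≤ ∫ z, Real.exp (c * ‖z‖ ^ 2) ∂(stdGaussian (Vec d)) :=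
    integral_nonneg fun _ => (Real.exp_pos _).le
  refine ⟨1 / c, (∫ z, Real.exp (c * ‖z‖ ^ 2) ∂(stdGaussian (Vec d))) / c, by positivity,
    by positivity, fun g hg hg0 hg1 hpos => ?_⟩
  set γ := stdGaussian (Vec d)
  set D := ∫ z, Real.exp (c * ‖z‖ ^ 2) ∂γ with hD
  set h := ∫ z, g z ∂γ with hh
  have habs : ∀ z, ‖g z‖ ≤ 1 := fun z => by
    rw [Real.norm_eq_abs, abs_of_nonneg (hg0 z)]; exact hg1 z
  have hbdd : ∀ {f : Vec d → ℝ}, Integrable f γ → Integrable (fun z => g z * f z) γ :=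
    fun hf => hf.bdd_mul (c := 1) hg.aestronglyMeasurable (ae_of_all _ habs)
  have hgint : Integrable g γ := by simpa using hbdd (integrable_const (1 : ℝ))
  have h1 : Integrable (fun z : Vec d => ‖z‖) γ := (IsGaussian.integrable_id (μ := γ)).norm
  have h2 : Integrable (fun z : Vec d => ‖z‖ ^ 2) γ :=
    (IsGaussian.memLp_two_id (μ := γ)).integrable_norm_pow (by norm_num)
  have hg1' := hbdd h1
  have hg2' := hbdd h2
  set m1 := ∫ z, g z * ‖z‖ ∂γ with hm1
  set m2 := ∫ z, g z * ‖z‖ ^ 2 ∂γ with hm2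
  have hVm1 : ‖∫ z, g z • z ∂γ‖ ≤ m1 := by
    refine (norm_integral_le_integral_norm _).trans (le_of_eq ?_)
    refine integral_congr_ae (ae_of_all _ fun z => ?_)
    simp only
    rw [norm_smul, Real.norm_eq_abs, abs_of_nonneg (hg0 z)]
  -- Cauchy–Schwarz for the measure with density `g`, read off from `∫ g (h‖z‖ - m1)² ≥ 0`.
  have hcs : m1 ^ 2 ≤ h * m2 := by
    have hnn : 0 ≤ ∫ z, (h ^ 2 * (g z * ‖z‖ ^ 2) - 2 * h * m1 * (g z * ‖z‖) + m1 ^ 2 * g z) ∂γ :=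
      integral_nonneg fun z => by
        have : h ^ 2 * (g z * ‖z‖ ^ 2) - 2 * h * m1 * (g z * ‖z‖) + m1 ^ 2 * g z
            = g z * (h * ‖z‖ - m1) ^ 2 := by ring
        simp only [Pi.zero_apply, this]
        exact mul_nonneg (hg0 z) (sq_nonneg _)
    have hsub : Integrable
        (fun z => h ^ 2 * (g z * ‖z‖ ^ 2) - 2 * h * m1 * (g z * ‖z‖)) γ :=
      (hg2'.const_mul _).sub (hg1'.const_mul _)
    rw [integral_add hsub (hgint.const_mul _),
      integral_sub (hg2'.const_mul _) (hg1'.const_mul _), integral_const_mul, integral_const_mul,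
      integral_const_mul, ← hm1, ← hm2, ← hh] at hnn
    have : 0 ≤ h * (h * m2 - m1 ^ 2) := by nlinarith
    linarith [nonneg_of_mul_nonneg_right this hpos]
  -- `1 + t ≤ exp t` at `t = c‖z‖² + log h` gives `c‖z‖² ≤ -log h + h exp(c‖z‖²)`. Multiplied by
  -- `g`, with `g ≤ 1` used on the exponential, both terms integrate to multiples of `h`; this
  -- supplies the second factor `h` of the bound.
  have hm2le : m2 ≤ h * (1 / c * -Real.log h + D / c) := by
    have hpt : ∀ z : Vec d, g z * ‖z‖ ^ 2
        ≤ (-Real.log h / c) * g z + h / c * Real.exp (c * ‖z‖ ^ 2) := fun z => by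
      have he := Real.add_one_le_exp (c * ‖z‖ ^ 2 + Real.log h)
      rw [Real.exp_add, Real.exp_log hpos] at he
      have hlin : c * ‖z‖ ^ 2 ≤ -Real.log h + h * Real.exp (c * ‖z‖ ^ 2) := by linarith
      have hep : 0 ≤ h * Real.exp (c * ‖z‖ ^ 2) := by positivity
      have : g z * (c * ‖z‖ ^ 2) ≤ -Real.log h * g z + h * Real.exp (c * ‖z‖ ^ 2) := by
        nlinarith [hg0 z, hg1 z, mul_le_mul_of_nonneg_left hlin (hg0 z),
          mul_le_mul_of_nonneg_right (hg1 z) hep]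
      have h3 : g z * ‖z‖ ^ 2 = g z * (c * ‖z‖ ^ 2) / c := by field_simp
      rw [h3, div_le_iff₀ hc]
      refine this.trans (le_of_eq ?_)
      field_simp
    refine (integral_mono hg2' ((hgint.const_mul _).add (hexp.const_mul _)) hpt).trans
      (le_of_eq ?_)
    simp only [Pi.add_apply]
    rw [integral_add (hgint.const_mul _) (hexp.const_mul _), integral_const_mul,
      integral_const_mul, ← hh, ← hD]
    ring
  calc ‖∫ z, g z • z ∂γ‖ ^ 2 ≤ m1 ^ 2 := pow_le_pow_left₀ (norm_nonneg _) hVm1 2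
    _ ≤ h * m2 := hcs
    _ ≤ h * (h * (1 / c * -Real.log h + D / c)) := mul_le_mul_of_nonneg_left hm2le hpos.le
    _ = _ := by ring

/-! ### The truncated ratio -/

section TruncatedRatio

theorem neg_log_le_neg_log_add_div {h η : ℝ} (hh : 0 < h) (hη : 0 < η) :
    -Real.log h ≤ -Real.log η + η / h := by
  have := Real.log_le_sub_one_of_pos (div_pos hη hh)
  rw [Real.log_div hη.ne' hh.ne'] at this
  linarith

/-- `h * -log h` is not monotone on `(0, 1)`, so the comparison with `η` goes through `-log h ≤ -log
η + η / h`, at the price of the extra term `a η`. This controls the truncated states once the tilted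
density has supplied a factor `h`. -/
theorem mul_entropy_le {h η a b : ℝ} (hh : 0 < h) (hη : 0 < η) (hη1 : η ≤ 1) (ha : 0 ≤ a)
    (hb : 0 ≤ b) (hlt : h < η) :
    h * (a * -Real.log h + b) ≤ (a * -Real.log η + a + b) * η := by
  have hl : 0 ≤ -Real.log η := by linarith [Real.log_nonpos hη.le hη1]
  have h1 : h * -Real.log h ≤ h * -Real.log η + η := by
    have := mul_le_mul_of_nonneg_left (neg_log_le_neg_log_add_div hh hη) hh.le
    rw [mul_add, mul_div_cancel₀ _ hh.ne'] at this
    exact this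
  nlinarith [mul_le_mul_of_nonneg_left h1 ha, mul_le_mul_of_nonneg_left hlt.le hb,
    mul_le_mul_of_nonneg_left hlt.le (mul_nonneg ha hl)]

/-- This keeps `‖v‖² / (h ∨ η)²` below a quantity logarithmic in `η`, so an error in the denominator
costs no further power of `η⁻¹`. -/
theorem sq_mul_entropy_le {h η a b : ℝ} (hh : 0 < h) (hη : 0 < η) (hη1 : η ≤ 1) (ha : 0 ≤ a)
    (hb : 0 ≤ b) :
    h ^ 2 * (a * -Real.log h + b) ≤ (a * -Real.log η + a + b) * max h η ^ 2 := by
  have hl : 0 ≤ -Real.log η := by linarith [Real.log_nonpos hη.le hη1]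
  rcases lt_or_ge h η with hlt | hge
  · rw [max_eq_right hlt.le]
    have h1 := mul_entropy_le hh hη hη1 ha hb hlt
    have hR : 0 ≤ a * -Real.log η + a + b := by positivity
    calc h ^ 2 * (a * -Real.log h + b) = h * (h * (a * -Real.log h + b)) := by ring
      _ ≤ h * ((a * -Real.log η + a + b) * η) := mul_le_mul_of_nonneg_left h1 hh.le
      _ ≤ η * ((a * -Real.log η + a + b) * η) :=
          mul_le_mul_of_nonneg_right hlt.le (by positivity)
      _ = _ := by ring
  · rw [max_eq_left hge, mul_comm]
    have : -Real.log h ≤ -Real.log η := neg_le_neg (Real.log_le_log hη hge)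
    gcongr
    nlinarith

theorem norm_add_add_sq_le {F : Type*} [NormedAddCommGroup F] (x y z : F) :
    ‖x + y + z‖ ^ 2 ≤ 3 * (‖x‖ ^ 2 + ‖y‖ ^ 2 + ‖z‖ ^ 2) := by
  have h1 : ‖x + y + z‖ ≤ ‖x‖ + ‖y‖ + ‖z‖ := norm_add₃_le
  have h2 := pow_le_pow_left₀ (norm_nonneg _) h1 2
  nlinarith [sq_nonneg (‖x‖ - ‖y‖), sq_nonneg (‖y‖ - ‖z‖), sq_nonneg (‖x‖ - ‖z‖)]

/-- Error of the truncated plug-in ratio `v' / (h' ∨ η)` as an approximation of `v / h`. -/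
theorem norm_truncated_ratio_sub_sq_le {F : Type*} [NormedAddCommGroup F] [NormedSpace ℝ F]
    {v v' : F} {h h' η a b : ℝ} (hh : 0 < h) (hη : 0 < η) (hη1 : η ≤ 1) (ha : 0 ≤ a)
    (hb : 0 ≤ b) (hv : ‖v‖ ^ 2 ≤ h ^ 2 * (a * -Real.log h + b)) :
    ‖(max h' η)⁻¹ • v' - h⁻¹ • v‖ ^ 2 ≤
      3 * ((1 + (a * -Real.log η + a + b)) / η ^ 2 * (‖v' - v‖ ^ 2 + (h' - h) ^ 2)
        + if h < η then a * -Real.log h + b else 0) := by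
  set R := a * -Real.log η + a + b with hR
  have hl : 0 ≤ -Real.log η := by linarith [Real.log_nonpos hη.le hη1]
  have hR0 : 0 ≤ R := by positivity
  have hm' : η ≤ max h' η := le_max_right _ _
  have hm : 0 < max h η := hη.trans_le (le_max_right _ _)
  have hm'0 : 0 < max h' η := hη.trans_le hm'
  -- The three terms are the error of the numerator, the error of the denominator (`· ∨ η` being
  -- 1-Lipschitz), and the truncation bias, which vanishes unless `h < η`.
  have hdec : (max h' η)⁻¹ • v' - h⁻¹ • v = (max h' η)⁻¹ • (v' - v)
      + ((max h' η)⁻¹ - (max h η)⁻¹) • v + ((max h η)⁻¹ - h⁻¹) • v := by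
    simp only [smul_sub, sub_smul]; abel
  have h1 : ‖(max h' η)⁻¹ • (v' - v)‖ ^ 2 ≤ ‖v' - v‖ ^ 2 / η ^ 2 := by
    rw [norm_smul, mul_pow, Real.norm_eq_abs, sq_abs, inv_pow, inv_mul_eq_div]
    gcongr
  have h2 : ‖((max h' η)⁻¹ - (max h η)⁻¹) • v‖ ^ 2 ≤ R * (h' - h) ^ 2 / η ^ 2 := by
    have hv2 : ‖v‖ ^ 2 ≤ R * max h η ^ 2 := hv.trans (sq_mul_entropy_le hh hη hη1 ha hb)
    have hd : (max h η - max h' η) ^ 2 ≤ (h' - h) ^ 2 := by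
      rw [sq_le_sq, abs_sub_comm h' h]
      exact abs_max_sub_max_le_abs h h' η
    rw [norm_smul, mul_pow, Real.norm_eq_abs, sq_abs, inv_sub_inv hm'0.ne' hm.ne', div_pow,
      mul_pow, div_mul_eq_mul_div, div_le_div_iff₀ (by positivity) (by positivity)]
    calc (max h η - max h' η) ^ 2 * ‖v‖ ^ 2 * η ^ 2
        ≤ (h' - h) ^ 2 * (R * max h η ^ 2) * max h' η ^ 2 := by gcongr
      _ = _ := by ring
  have h3 : ‖((max h η)⁻¹ - h⁻¹) • v‖ ^ 2 ≤ if h < η then a * -Real.log h + b else 0 := by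
    split_ifs with hlt
    · rw [max_eq_right hlt.le, norm_smul, mul_pow, Real.norm_eq_abs, sq_abs]
      have hle : (η⁻¹ - h⁻¹) ^ 2 ≤ (h⁻¹) ^ 2 := by
        have := inv_anti₀ hh hlt.le
        have : 0 < η⁻¹ := inv_pos.2 hη
        nlinarith
      calc (η⁻¹ - h⁻¹) ^ 2 * ‖v‖ ^ 2
          ≤ (h⁻¹) ^ 2 * (h ^ 2 * (a * -Real.log h + b)) := by gcongr
        _ = _ := by field_simp
    · rw [max_eq_left (not_lt.1 hlt)]; simp
  rw [hdec]
  refine (norm_add_add_sq_le _ _ _).trans ?_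
  have h4 : (1 + R) / η ^ 2 * (‖v' - v‖ ^ 2 + (h' - h) ^ 2)
      = ‖v' - v‖ ^ 2 / η ^ 2 + R * (h' - h) ^ 2 / η ^ 2
        + (R * ‖v' - v‖ ^ 2 / η ^ 2 + (h' - h) ^ 2 / η ^ 2) := by ring
  have h5 : 0 ≤ R * ‖v' - v‖ ^ 2 / η ^ 2 + (h' - h) ^ 2 / η ^ 2 := by positivity
  linarith

end TruncatedRatio

/-! ### Gradient of `log h` and of its estimator -/

noncomputable section

namespace DiffusionSampler

open scoped RealInnerProductSpace

variable {d L : ℕ} {S : DiffusionSampler d L}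

theorem differentiable_mean
    (hd : ∀ l, 1 ≤ l → l ≤ L → Differentiable ℝ fun x => S.score x (S.t l)) {l : ℕ} (hl : 1 ≤ l)
    (hlL : l ≤ L) : Differentiable ℝ (S.mean l) := by
  have := hd l hl hlL
  unfold mean
  fun_prop

theorem norm_fderiv_mean_le {l : ℕ} {x : Vec d} {G B : ℝ}
    (hd : DifferentiableAt ℝ (fun x => S.score x (S.t l)) x)
    (hG : ‖fderiv ℝ (fun x' => S.score x' (S.t l)) x‖ ≤ G) (ha : |S.a l| ≤ B)
    (hb : |S.b l| ≤ B) : ‖fderiv ℝ (S.mean l) x‖ ≤ B + B * G := by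
  have h : HasFDerivAt (S.mean l) (S.a l • ContinuousLinearMap.id ℝ (Vec d)
      + S.b l • fderiv ℝ (fun x' => S.score x' (S.t l)) x) x :=
    ((hasFDerivAt_id x).const_smul (S.a l)).add (hd.hasFDerivAt.const_smul (S.b l))
  have hB : 0 ≤ B := (abs_nonneg _).trans ha
  rw [h.fderiv]
  refine (norm_add_le _ _).trans (add_le_add ?_ ?_)
  · rw [norm_smul, Real.norm_eq_abs]
    exact (mul_le_of_le_one_right (abs_nonneg _) ContinuousLinearMap.norm_id_le).trans ha
  · rw [norm_smul, Real.norm_eq_abs]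
    exact mul_le_mul hb hG (norm_nonneg _) hB

/-- The score of the Gaussian transition, differentiated in the conditioning state. -/
theorem gradient_log_transitionDensity {l : ℕ} {x : Vec d} (hσ : 0 < S.σ l)
    (hd : DifferentiableAt ℝ (S.mean l) x) (w : Vec d) :
    gradient (fun x' => Real.log (S.transitionDensity l x' (S.step l x w))) x
      = (S.σ l)⁻¹ • ContinuousLinearMap.adjoint (fderiv ℝ (S.mean l) x) w := by
  have hlog : (fun x' => Real.log (S.transitionDensity l x' (S.step l x w))) = fun x' =>
      Real.log ((2 * Real.pi * S.σ l ^ 2) ^ (-(d : ℝ) / 2))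
        + -1 / (2 * S.σ l ^ 2) * ‖S.step l x w - S.mean l x'‖ ^ 2 := by
    funext x'
    rw [transitionDensity, Real.log_mul (by positivity) (Real.exp_pos _).ne', Real.log_exp]
    congr 1
    ring
  have h1 : HasFDerivAt (fun x' => S.step l x w - S.mean l x') (-(fderiv ℝ (S.mean l) x)) x :=
    hd.hasFDerivAt.const_sub _
  have h2 := ((hasStrictFDerivAt_norm_sq (S.step l x w - S.mean l x)).hasFDerivAt.comp x
    h1).const_mul (-1 / (2 * S.σ l ^ 2))
  have h3 := h2.const_add (Real.log ((2 * Real.pi * S.σ l ^ 2) ^ (-(d : ℝ) / 2)))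
  have hstep : S.step l x w - S.mean l x = S.σ l • w := by simp [step]
  refine HasGradientAt.gradient ?_
  rw [hlog, hasGradientAt_iff_hasFDerivAt]
  refine h3.congr_fderiv ?_
  ext v
  simp only [hstep, InnerProductSpace.toDual_apply_apply, real_inner_smul_left,
    ContinuousLinearMap.adjoint_inner_left]
  simp
  field_simp

section Event

variable {𝒰 : Type*} [MeasurableSpace 𝒰] (ν : Measure 𝒰) (A : Set (Vec d × 𝒰))

variable (S) in
/-- The Gaussian average `𝔼[h(X_k) Z]` over one reverse step `X_k = μ(x) + σ Z` from `x`. -/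
def weightedNoise (k : ℕ) (x : Vec d) : Vec d :=
  ∫ w, S.doobH ν A k (S.step (k + 1) x w) • w ∂(stdGaussian (Vec d))

variable (S) in
/-- The Monte Carlo estimator of `weightedNoise`. -/
def weightedNoiseHat (k M : ℕ) (z : Fin M → Fin (k + 1) → Vec d) (x : Vec d) : Vec d :=
  (1 / (M : ℝ)) • ∑ m, S.doobH ν A 0 (S.rollout (k + 1) x (z m)) • z m (Fin.last k)

variable {ν A} [IsProbabilityMeasure ν]

omit [IsProbabilityMeasure ν] in
theorem gradHHat_eq {k M : ℕ} (hσ : 0 < S.σ (k + 1)) {x : Vec d}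
    (hd : DifferentiableAt ℝ (S.mean (k + 1)) x) (z : Fin M → Fin (k + 1) → Vec d) :
    S.gradHHat ν A k M z x = (S.σ (k + 1))⁻¹ •
      ContinuousLinearMap.adjoint (fderiv ℝ (S.mean (k + 1)) x) (S.weightedNoiseHat ν A k M z x) := by
  simp only [gradHHat, weightedNoiseHat, gradient_log_transitionDensity hσ hd, map_smul, map_sum]
  rw [smul_comm _ (1 / (M : ℝ)), Finset.smul_sum (r := (S.σ (k + 1))⁻¹)]
  congr 1
  exact Finset.sum_congr rfl fun m _ => smul_comm _ _ _

/-- One nondegenerate Gaussian step already smooths: `h` at time `t_k` is only bounded and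
measurable here, and the later steps may have zero variance. -/
theorem hasFDerivAt_doobH_succ (hA : MeasurableSet A)
    (hS : ∀ l, 1 ≤ l → l ≤ L → Measurable fun x => S.score x (S.t l)) {k : ℕ} (hk : k + 1 ≤ L)
    (hσ : 0 < S.σ (k + 1)) {x : Vec d} (hd : DifferentiableAt ℝ (S.mean (k + 1)) x) :
    HasFDerivAt (S.doobH ν A (k + 1))
      (((S.σ (k + 1))⁻¹ • innerSL ℝ (S.weightedNoise ν A k x)).comp
        (fderiv ℝ (S.mean (k + 1)) x)) x := by
  have heq : S.doobH ν A (k + 1) = fun x =>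
      ∫ w, S.doobH ν A k (S.mean (k + 1) x + S.σ (k + 1) • w) ∂(stdGaussian (Vec d)) :=
    funext fun x => doobH_succ hA hS hk x
  rw [heq]
  exact (hasFDerivAt_integral_add_smul_stdGaussian (measurable_doobH hA hS (by omega))
    (fun z => abs_doobH_le_one _ _) hσ (S.mean (k + 1) x)).comp x hd.hasFDerivAt

theorem gradient_log_doobH (hA : MeasurableSet A)
    (hS : ∀ l, 1 ≤ l → l ≤ L → Measurable fun x => S.score x (S.t l)) {k : ℕ} (hk : k + 1 ≤ L)
    (hσ : 0 < S.σ (k + 1)) {x : Vec d} (hd : DifferentiableAt ℝ (S.mean (k + 1)) x)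
    (hx : 0 < S.doobH ν A (k + 1) x) :
    gradient (fun x' => Real.log (S.doobH ν A (k + 1) x')) x
      = (S.σ (k + 1))⁻¹ • ContinuousLinearMap.adjoint (fderiv ℝ (S.mean (k + 1)) x)
          ((S.doobH ν A (k + 1) x)⁻¹ • S.weightedNoise ν A k x) := by
  refine HasGradientAt.gradient ?_
  rw [hasGradientAt_iff_hasFDerivAt]
  refine ((hasFDerivAt_doobH_succ hA hS hk hσ hd).log hx.ne').congr_fderiv ?_
  ext v
  have h := ContinuousLinearMap.adjoint_inner_left (fderiv ℝ (S.mean (k + 1)) x) v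
    (S.weightedNoise ν A k x)
  simp [h]
  ring

/-- Both gradients are images under the same linear map `σ⁻¹ Jᵀ`, the sampled `y` satisfying `y -
μ(x) = σ w`. The Jacobian of the mean therefore enters only through its norm. -/
theorem norm_gradLogHHat_sub_sq_le (hA : MeasurableSet A)
    (hS : ∀ l, 1 ≤ l → l ≤ L → Measurable fun x => S.score x (S.t l)) {k M : ℕ} (hk : k + 1 ≤ L)
    (hσ : 0 < S.σ (k + 1)) {x : Vec d} (hd : DifferentiableAt ℝ (S.mean (k + 1)) x)
    (hx : 0 < S.doobH ν A (k + 1) x) {K : ℝ} (hK : ‖fderiv ℝ (S.mean (k + 1)) x‖ ≤ K)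
    (η : ℝ) (z : Fin M → Fin (k + 1) → Vec d) :
    ‖S.gradLogHHat ν A k M η z x - gradient (fun x' => Real.log (S.doobH ν A (k + 1) x')) x‖ ^ 2
      ≤ K ^ 2 / S.σ (k + 1) ^ 2 *
        ‖(max (S.hHat ν A (k + 1) M z x) η)⁻¹ • S.weightedNoiseHat ν A k M z x
          - (S.doobH ν A (k + 1) x)⁻¹ • S.weightedNoise ν A k x‖ ^ 2 := by
  rw [gradLogHHat, gradHHat_eq hσ hd, gradient_log_doobH hA hS hk hσ hd hx, smul_comm,
    ← map_smul, ← smul_sub, ← map_sub, norm_smul, mul_pow, Real.norm_eq_abs, sq_abs, inv_pow,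
    div_eq_inv_mul, mul_assoc]
  refine mul_le_mul_of_nonneg_left ?_ (by positivity)
  rw [← mul_pow]
  refine pow_le_pow_left₀ (norm_nonneg _) ?_ 2
  refine (ContinuousLinearMap.le_opNorm _ _).trans ?_
  rw [LinearIsometryEquiv.norm_map]
  gcongr

theorem measurable_doobH_step (hA : MeasurableSet A)
    (hS : ∀ l, 1 ≤ l → l ≤ L → Measurable fun x => S.score x (S.t l)) {k : ℕ} (hk : k + 1 ≤ L)
    (x : Vec d) : Measurable fun w => S.doobH ν A k (S.step (k + 1) x w) := by
  have h := (measurable_step hS (Nat.succ_pos k) hk).comp (measurable_prodMk_left (x := x))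
  exact (measurable_doobH hA hS (Nat.le_of_succ_le hk)).comp h

theorem measurable_weightedNoise (hA : MeasurableSet A)
    (hS : ∀ l, 1 ≤ l → l ≤ L → Measurable fun x => S.score x (S.t l)) {k : ℕ} (hk : k + 1 ≤ L) :
    Measurable (S.weightedNoise ν A k) := by
  have h : Measurable fun p : Vec d × Vec d => S.doobH ν A k (S.step (k + 1) p.1 p.2) • p.2 :=
    ((measurable_doobH hA hS (by omega)).comp
      (measurable_step hS (by omega) hk)).smul measurable_snd
  exact (h.stronglyMeasurable.integral_prod_right (ν := stdGaussian (Vec d))).measurable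

theorem measurable_doobH_rollout (hA : MeasurableSet A)
    (hS : ∀ l, 1 ≤ l → l ≤ L → Measurable fun x => S.score x (S.t l)) {l : ℕ} (hl : l ≤ L) :
    Measurable fun p : Vec d × (Fin l → Vec d) => S.doobH ν A 0 (S.rollout l p.1 p.2) :=
  (measurable_doobH_zero hA).comp (measurable_rollout hS hl)

theorem measurable_doobH_rollout_right (hA : MeasurableSet A)
    (hS : ∀ l, 1 ≤ l → l ≤ L → Measurable fun x => S.score x (S.t l)) {l : ℕ} (hl : l ≤ L)
    (x : Vec d) : Measurable fun z : Fin l → Vec d => S.doobH ν A 0 (S.rollout l x z) :=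
  (measurable_doobH_rollout hA hS hl).comp measurable_prodMk_left

theorem measurable_hHat (hA : MeasurableSet A)
    (hS : ∀ l, 1 ≤ l → l ≤ L → Measurable fun x => S.score x (S.t l)) {l M : ℕ} (hl : l ≤ L) :
    Measurable fun p : Vec d × (Fin M → Fin l → Vec d) => S.hHat ν A l M p.2 p.1 := by
  have h := measurable_doobH_rollout (ν := ν) hA hS hl
  unfold hHat
  refine Measurable.const_mul (Finset.measurable_sum (M := ℝ) _ fun m _ => ?_) _
  exact h.comp (measurable_fst.prodMk ((measurable_pi_apply m).comp measurable_snd))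

theorem measurable_weightedNoiseHat (hA : MeasurableSet A)
    (hS : ∀ l, 1 ≤ l → l ≤ L → Measurable fun x => S.score x (S.t l)) {k M : ℕ} (hk : k + 1 ≤ L) :
    Measurable fun p : Vec d × (Fin M → Fin (k + 1) → Vec d) =>
      S.weightedNoiseHat ν A k M p.2 p.1 := by
  have h := measurable_doobH_rollout (ν := ν) hA hS hk
  unfold weightedNoiseHat
  refine Measurable.const_smul (Finset.measurable_sum (M := Vec d) _ fun m _ => ?_) (1 / (M : ℝ))
  have hm : Measurable fun p : Vec d × (Fin M → Fin (k + 1) → Vec d) => p.2 m :=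
    (measurable_pi_apply m).comp measurable_snd
  exact (h.comp (measurable_fst.prodMk hm)).smul ((measurable_pi_apply (Fin.last k)).comp hm)

theorem measurable_estimator_error (hA : MeasurableSet A)
    (hS : ∀ l, 1 ≤ l → l ≤ L → Measurable fun x => S.score x (S.t l)) {k : ℕ} (hk : k + 1 ≤ L)
    (M : ℕ) (c : ℝ) :
    Measurable (Function.uncurry fun x z => c *
      (‖S.weightedNoiseHat ν A k M z x - S.weightedNoise ν A k x‖ ^ 2
        + (S.hHat ν A (k + 1) M z x - S.doobH ν A (k + 1) x) ^ 2)) := by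
  have h1 := measurable_weightedNoiseHat (ν := ν) (M := M) hA hS hk
  have h2 := measurable_hHat (ν := ν) (M := M) hA hS hk
  have hfst : Measurable (Prod.fst : Vec d × (Fin M → Fin (k + 1) → Vec d) → Vec d) :=
    measurable_fst
  have h3 := (measurable_weightedNoise (ν := ν) hA hS hk).comp hfst
  have h4 := (measurable_doobH (ν := ν) hA hS hk).comp hfst
  exact (((h1.sub h3).norm.pow_const 2).add ((h2.sub h4).pow_const 2)).const_mul c

end Event

end DiffusionSampler

/-! ### Concentration of the Monte Carlo averages at a fixed state -/

theorem exp_min_mul_add_le {κ₁ κ₂ u v : ℝ} (hu : 0 ≤ u) (hv : 0 ≤ v) :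
    Real.exp (min κ₁ κ₂ / 2 * (u + v)) ≤ Real.exp (κ₁ * u) + Real.exp (κ₂ * v) := by
  have h1 : min κ₁ κ₂ * u ≤ κ₁ * u := mul_le_mul_of_nonneg_right (min_le_left _ _) hu
  have h2 : min κ₁ κ₂ * v ≤ κ₂ * v := mul_le_mul_of_nonneg_right (min_le_right _ _) hv
  -- The exponent is at most the mean of `κ₁ u` and `κ₂ v`, hence at most the larger; the two moment
  -- bounds can thus be joined although the two errors are dependent.
  have h3 : min κ₁ κ₂ / 2 * (u + v) = (min κ₁ κ₂ * u + min κ₁ κ₂ * v) / 2 := by ring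
  rcases le_total (κ₁ * u) (κ₂ * v) with hle | hle
  · have := Real.exp_le_exp.2 (show min κ₁ κ₂ / 2 * (u + v) ≤ κ₂ * v by linarith)
    linarith [Real.exp_pos (κ₁ * u)]
  · have := Real.exp_le_exp.2 (show min κ₁ κ₂ / 2 * (u + v) ≤ κ₁ * u by linarith)
    linarith [Real.exp_pos (κ₂ * v)]

/-- Square-exponential concentration of averages of independent copies of a random vector that is
dominated by a standard Gaussian vector. -/
theorem exists_lintegral_exp_mean_error_le {F : Type*} [NormedAddCommGroup F]
    [InnerProductSpace ℝ F] [FiniteDimensional ℝ F] [MeasurableSpace F] [BorelSpace F] {f : F → ℝ}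
    (hf : Measurable f) (hf1 : Integrable f (stdGaussian F)) {c : ℝ} (hc : 0 < c)
    (hexp : Integrable (fun w => Real.exp (c * f w ^ 2)) (stdGaussian F))
    (E : Type*) [NormedAddCommGroup E] [InnerProductSpace ℝ E] [FiniteDimensional ℝ E]
    [MeasurableSpace E] [BorelSpace E] :
    ∃ κ D : ℝ, 0 < κ ∧ 0 < D ∧ ∀ {Ω : Type} [MeasurableSpace Ω] {P : Measure Ω}
      [IsProbabilityMeasure P] {Z : Ω → F}, MeasurePreserving Z P (stdGaussian F) →
      ∀ {Y : Ω → E}, Measurable Y → (∀ ω, ‖Y ω‖ ≤ f (Z ω)) → ∀ {M : ℕ}, 0 < M →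
      ∫⁻ z, ENNReal.ofReal (Real.exp (κ * (M *
          ‖(1 / (M : ℝ)) • ∑ m, Y (z m) - ∫ ω, Y ω ∂P‖ ^ 2)))
        ∂(Measure.pi fun _ : Fin M => P) ≤ ENNReal.ofReal D := by
  set I := ∫ w, Real.exp (c * f w ^ 2) ∂(stdGaussian F) with hI
  set m1 := ∫ w, f w ∂(stdGaussian F) with hm1
  have hIpos : 0 < I := integral_exp_pos hexp
  -- Centring costs `‖Y - V‖² ≤ 2 f(Z)² + 2 m1²`, whence the halved constant `c / 2` and the
  -- prefactor `exp(c m1²)`.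
  obtain ⟨κ, D, hκ, hD, H⟩ := exists_lintegral_exp_sq_sum_le E
    (half_pos hc) (D := Real.exp (c * m1 ^ 2) * I) (by positivity)
  refine ⟨κ, D, hκ, hD, ?_⟩
  intro Ω _ P _ Z hZ Y hY hYf M hM
  have hM' : (0 : ℝ) < M := by exact_mod_cast hM
  set V := ∫ ω, Y ω ∂P with hV
  have hfZ : Integrable (fun ω => f (Z ω)) P := hZ.integrable_comp_of_integrable hf1
  have hYint : Integrable Y P := hfZ.mono' hY.aestronglyMeasurable (ae_of_all _ hYf)
  have hfZm1 : ∫ ω, f (Z ω) ∂P = m1 := by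
    rw [hm1, ← hZ.map_eq, integral_map hZ.measurable.aemeasurable hf.aestronglyMeasurable]
  have hVm1 : ‖V‖ ≤ m1 := hfZm1 ▸ norm_integral_le_of_norm_le hfZ (ae_of_all _ hYf)
  have hle : ∀ ω, Real.exp (c / 2 * ‖Y ω - V‖ ^ 2)
      ≤ Real.exp (c * m1 ^ 2) * Real.exp (c * f (Z ω) ^ 2) := fun ω => by
    rw [← Real.exp_add]
    refine Real.exp_le_exp.2 ?_
    have h1 := pow_le_pow_left₀ (norm_nonneg _)
      ((norm_sub_le _ _).trans (add_le_add (hYf ω) hVm1)) 2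
    have h2 := add_sq_le (a := f (Z ω)) (b := m1)
    nlinarith [mul_le_mul_of_nonneg_left (h1.trans h2) hc.le]
  have hexpZ : Integrable (fun ω => Real.exp (c * f (Z ω) ^ 2)) P :=
    hZ.integrable_comp_of_integrable hexp
  have hYexp : Integrable (fun ω => Real.exp (c / 2 * ‖Y ω - V‖ ^ 2)) P :=
    (hexpZ.const_mul (Real.exp (c * m1 ^ 2))).mono'
      ((((hY.sub_const V).norm.pow_const 2).const_mul _).exp).aestronglyMeasurable
      (ae_of_all _ fun ω => by
        rw [Real.norm_eq_abs, Real.abs_exp]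
        exact hle ω)
  have hYD : ∫ ω, Real.exp (c / 2 * ‖Y ω - V‖ ^ 2) ∂P ≤ Real.exp (c * m1 ^ 2) * I := by
    refine (integral_mono hYexp (hexpZ.const_mul _) hle).trans (le_of_eq ?_)
    rw [integral_const_mul, hI, ← hZ.map_eq, integral_map hZ.measurable.aemeasurable
      (((hf.pow_const 2).const_mul c).exp).aestronglyMeasurable]
  have hY0 : ∫ ω, (Y ω - V) ∂P = 0 := by
    rw [integral_sub hYint (integrable_const _), integral_const, probReal_univ, one_smul, hV,
      sub_self]
  refine le_trans (le_of_eq (lintegral_congr fun z => ?_))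
    (H P (fun ω => Y ω - V) (hY.sub_const _) hYexp hYD hY0 M hM)
  have hsum : ∑ m, (Y (z m) - V) = (M : ℝ) • ((1 / (M : ℝ)) • ∑ m, Y (z m) - V) := by
    rw [Finset.sum_sub_distrib, Finset.sum_const, Finset.card_univ,
      Fintype.card_fin, smul_sub, smul_smul, mul_one_div_cancel hM'.ne', one_smul,
      Nat.cast_smul_eq_nsmul]
  rw [hsum, norm_smul, mul_pow, Real.norm_of_nonneg hM'.le]
  congr 3
  field_simp

/-- Joint square-exponential concentration of the averages of `g` and of `g Z`, for a bounded
weight `g` and a standard Gaussian vector `Z` entering the noise last. -/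
theorem exists_lintegral_exp_weighted_mean_error_le (d : ℕ) : ∃ κ D : ℝ, 0 < κ ∧ 1 ≤ D ∧
    ∀ {k : ℕ} {g : (Fin (k + 1) → Vec d) → ℝ}, Measurable g → (∀ z, |g z| ≤ 1) →
      ∀ {M : ℕ}, 0 < M →
      ∫⁻ z, ENNReal.ofReal (Real.exp (κ * M *
          (‖(1 / (M : ℝ)) • ∑ m, g (z m) • z m (Fin.last k)
              - ∫ z, g z • z (Fin.last k) ∂(noiseLaw d (k + 1))‖ ^ 2
            + ((1 / (M : ℝ)) * ∑ m, g (z m) - ∫ z, g z ∂(noiseLaw d (k + 1))) ^ 2)))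
        ∂(mcLaw d (k + 1) M) ≤ ENNReal.ofReal D := by
  obtain ⟨c, hc, hexp⟩ := IsGaussian.exists_integrable_exp_sq (stdGaussian (Vec d))
  obtain ⟨κ₁, D₁, hκ₁, hD₁, H₁⟩ := exists_lintegral_exp_mean_error_le (F := Vec d)
    (f := fun w => ‖w‖) measurable_norm
    (IsGaussian.integrable_id (μ := stdGaussian (Vec d))).norm hc hexp (Vec d)
  obtain ⟨κ₂, D₂, hκ₂, hD₂, H₂⟩ := exists_lintegral_exp_mean_error_le (F := Vec d)
    (f := fun _ => (1 : ℝ)) measurable_const (integrable_const _) one_pos (integrable_const _) ℝ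
  refine ⟨min κ₁ κ₂ / 2, max 1 (D₁ + D₂), by positivity, le_max_left _ _, ?_⟩
  intro k g hg hg1 M hM
  have hgz : Measurable fun z : Fin (k + 1) → Vec d => g z • z (Fin.last k) :=
    hg.smul (measurable_pi_apply _)
  have B₁ := H₁ (measurePreserving_last d k) hgz (fun z => by
      rw [norm_smul, Real.norm_eq_abs]
      exact mul_le_of_le_one_left (norm_nonneg _) (hg1 z)) hM
  have B₂ := H₂ (measurePreserving_last d k) hg hg1 hM
  simp only [Real.norm_eq_abs, sq_abs, smul_eq_mul] at B₂
  have hmeas : Measurable fun z : Fin M → Fin (k + 1) → Vec d =>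
      ENNReal.ofReal (Real.exp (κ₁ * (M * ‖(1 / (M : ℝ)) • ∑ m, g (z m) • z m (Fin.last k)
        - ∫ z, g z • z (Fin.last k) ∂(noiseLaw d (k + 1))‖ ^ 2))) := by
    have hsum : Measurable fun z : Fin M → Fin (k + 1) → Vec d =>
        ∑ m, g (z m) • z m (Fin.last k) :=
      Finset.measurable_sum _ fun m _ => hgz.comp (measurable_pi_apply m)
    exact (((((hsum.const_smul (1 / (M : ℝ))).sub_const _).norm.pow_const 2).const_mul _).const_mul
      _).exp.ennreal_ofReal
  refine (lintegral_mono fun z => (ENNReal.ofReal_le_ofReal ?_).trans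
    ENNReal.ofReal_add_le).trans (((lintegral_add_left hmeas _).trans_le
      (add_le_add B₁ B₂)).trans ?_)
  · rw [mul_assoc, mul_add (M : ℝ)]
    exact exp_min_mul_add_le (by positivity) (by positivity)
  · rw [← ENNReal.ofReal_add hD₁.le hD₂.le]
    exact ENNReal.ofReal_le_ofReal (le_max_right _ _)

open DiffusionSampler in
/-- Joint square-exponential concentration of the Monte Carlo estimators at a fixed state, with
constants depending on the dimension only. -/
theorem exists_lintegral_exp_estimator_error_le (d : ℕ) : ∃ κ D : ℝ, 0 < κ ∧ 1 ≤ D ∧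
    ∀ {L : ℕ} {S : DiffusionSampler d L} {𝒰 : Type*} [MeasurableSpace 𝒰] {ν : Measure 𝒰}
      [IsProbabilityMeasure ν] {A : Set (Vec d × 𝒰)}, MeasurableSet A →
      (∀ l, 1 ≤ l → l ≤ L → Measurable fun x => S.score x (S.t l)) → ∀ {k : ℕ}, k + 1 ≤ L →
      ∀ {M : ℕ}, 0 < M → ∀ x : Vec d,
      ∫⁻ z, ENNReal.ofReal (Real.exp (κ * M *
          (‖S.weightedNoiseHat ν A k M z x - S.weightedNoise ν A k x‖ ^ 2
            + (S.hHat ν A (k + 1) M z x - S.doobH ν A (k + 1) x) ^ 2)))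
        ∂(mcLaw d (k + 1) M) ≤ ENNReal.ofReal D := by
  obtain ⟨κ, D, hκ, hD, H⟩ := exists_lintegral_exp_weighted_mean_error_le d
  refine ⟨κ, D, hκ, hD, ?_⟩
  intro L S 𝒰 _ ν _ A hA hS k hk M hM x
  -- Unbiasedness: the expectation of one summand of `weightedNoiseHat` is `weightedNoise`.
  have hV := integral_doobH_rollout_smul_last (ν := ν) hA hS hk x (f := fun w => w) measurable_id
    (IsGaussian.integrable_id (μ := stdGaussian (Vec d)))
  have h := H (measurable_doobH_rollout_right (ν := ν) hA hS hk x)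
    (fun z => abs_doobH_le_one _ _) hM
  rw [← doobH_eq_integral hA hS hk, hV] at h
  exact h

/-! ### Mean-squared error and the final rate -/

namespace DiffusionSampler

variable {d L : ℕ} {S : DiffusionSampler d L}
  {𝒰 : Type*} [MeasurableSpace 𝒰] {ν : Measure 𝒰} [IsProbabilityMeasure ν]
  {A : Set (Vec d × 𝒰)}

/-- Deterministic bound of the mean-squared error by the averaged square errors of the two Monte
Carlo estimators and the contribution of the states at which the truncation is active. -/
theorem mse_le {ρ K a b η : ℝ} (hA : MeasurableSet A)
    (hS : ∀ l, 1 ≤ l → l ≤ L → Measurable fun x => S.score x (S.t l)) {k M : ℕ} (hk : k + 1 ≤ L)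
    (hσ : 0 < S.σ (k + 1)) (hd : Differentiable ℝ (S.mean (k + 1)))
    (hK : ∀ x, ‖fderiv ℝ (S.mean (k + 1)) x‖ ≤ K) (hρ : 0 < ρ) (hev : ρ ≤ S.eventProb ν A)
    (hη : 0 < η) (hη1 : η ≤ 1) (ha : 0 ≤ a) (hb : 0 ≤ b)
    (hV : ∀ x, 0 < S.doobH ν A (k + 1) x → ‖S.weightedNoise ν A k x‖ ^ 2 ≤
      S.doobH ν A (k + 1) x ^ 2 * (a * -Real.log (S.doobH ν A (k + 1) x) + b))
    {c : ℝ} (hc : 0 < c) (z : Fin M → Fin (k + 1) → Vec d) :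
    S.mse ν A k M η z ≤ ENNReal.ofReal (3 * K ^ 2 / S.σ (k + 1) ^ 2) *
      (ENNReal.ofReal ((1 + (a * -Real.log η + a + b)) / η ^ 2 / c) *
        ∫⁻ x, ENNReal.ofReal (c * (‖S.weightedNoiseHat ν A k M z x - S.weightedNoise ν A k x‖ ^ 2
            + (S.hHat ν A (k + 1) M z x - S.doobH ν A (k + 1) x) ^ 2))
          ∂(S.tiltedMarginal ν A (k + 1))
        + ENNReal.ofReal ((a * -Real.log η + a + b) * η / ρ)) := by
  set R := a * -Real.log η + a + b with hR
  have hl : 0 ≤ -Real.log η := by linarith [Real.log_nonpos hη.le hη1]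
  have hR0 : 0 ≤ R := by positivity
  set W : Vec d → ℝ := fun x =>
    c * (‖S.weightedNoiseHat ν A k M z x - S.weightedNoise ν A k x‖ ^ 2
            + (S.hHat ν A (k + 1) M z x - S.doobH ν A (k + 1) x) ^ 2) with hW
  set q : Vec d → ℝ := fun x => if S.doobH ν A (k + 1) x < η then
    a * -Real.log (S.doobH ν A (k + 1) x) + b else 0 with hq
  have hW0 : ∀ x, 0 ≤ W x := fun x => by positivity
  have hhm := measurable_doobH (ν := ν) hA hS hk
  have hWm : Measurable W :=
    (measurable_estimator_error hA hS hk M c).of_uncurry_right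
  have hqm : Measurable q :=
    Measurable.ite (measurableSet_lt hhm measurable_const)
      ((hhm.log.neg.const_mul a).add_const b) measurable_const
  -- The bias `q` is unbounded as `h → 0`, but `h * q ≤ R η`, which is what integration against the
  -- tilted law requires.
  have hqint : ∫⁻ x, ENNReal.ofReal (q x) ∂(S.tiltedMarginal ν A (k + 1))
      ≤ ENNReal.ofReal (R * η / ρ) := by
    refine lintegral_tiltedMarginal_le hA hS hk hρ hev hqm fun x => ?_
    simp only [hq]
    split_ifs with hlt
    · rcases (doobH_nonneg (S := S) (ν := ν) (A := A) (k + 1) x).eq_or_lt with h0 | hpos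
      · rw [← h0, zero_mul]; positivity
      · exact mul_entropy_le hpos hη hη1 ha hb hlt
    · rw [mul_zero]; positivity
  have hpt : ∀ᵐ x ∂(S.tiltedMarginal ν A (k + 1)),
      ‖S.gradLogHHat ν A k M η z x
        - gradient (fun x' => Real.log (S.doobH ν A (k + 1) x')) x‖ₑ ^ 2
      ≤ ENNReal.ofReal (3 * K ^ 2 / S.σ (k + 1) ^ 2) *
        (ENNReal.ofReal ((1 + R) / η ^ 2 / c) * ENNReal.ofReal (W x)
          + ENNReal.ofReal (q x)) := by
    filter_upwards [ae_doobH_pos hA hS hk hρ hev] with x hx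
    have hq0 : 0 ≤ q x := by
      have := Real.log_nonpos hx.le (doobH_le_one (ν := ν) (A := A) (S := S) (k + 1) x)
      simp only [hq]
      split_ifs
      · nlinarith
      · exact le_rfl
    rw [← ofReal_norm, ← ENNReal.ofReal_pow (norm_nonneg _),
      ← ENNReal.ofReal_mul (by positivity), ← ENNReal.ofReal_add
        (mul_nonneg (by positivity) (hW0 x)) hq0, ← ENNReal.ofReal_mul (by positivity)]
    refine ENNReal.ofReal_le_ofReal ?_
    refine (norm_gradLogHHat_sub_sq_le hA hS hk hσ (hd x) hx (hK x) η z).trans ?_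
    have h := norm_truncated_ratio_sub_sq_le (v' := S.weightedNoiseHat ν A k M z x)
      (h' := S.hHat ν A (k + 1) M z x) hx hη hη1 ha hb (hV x hx)
    refine (mul_le_mul_of_nonneg_left h (by positivity)).trans (le_of_eq ?_)
    rw [← hR]
    simp only [hW, hq]
    field_simp
  refine (lintegral_mono_ae hpt).trans ?_
  have hWm' := hWm.ennreal_ofReal.const_mul (ENNReal.ofReal ((1 + R) / η ^ 2 / c))
  have hsum : Measurable fun x =>
      ENNReal.ofReal ((1 + R) / η ^ 2 / c) * ENNReal.ofReal (W x) + ENNReal.ofReal (q x) :=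
    hWm'.add hqm.ennreal_ofReal
  rw [lintegral_const_mul _ hsum, lintegral_add_left hWm', lintegral_const_mul _ hWm.ennreal_ofReal]
  gcongr

end DiffusionSampler

/-- Used with `y = M^(1/6) = η⁻¹` and `p = log(1/δ)`, so that `6 log y + p = log(M/δ)`. Since the
logarithm is at most `y`, the Monte Carlo term decays like `y⁻³` up to the factor `q`; the
truncation term `y⁻¹` dominates. Constants such as `log D` are absorbed into `q ≥ p₀`. -/
theorem rate_bound {a b κ D ρ p₀ p y : ℝ} (ha : 0 ≤ a) (hb : 0 ≤ b) (hκ : 0 < κ) (hD : 1 ≤ D)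
    (hρ : 0 < ρ) (hp₀ : 0 < p₀) (hp : p₀ ≤ p) (hy : 1 ≤ y) :
    (1 + (a * Real.log y + a + b)) / y⁻¹ ^ 2 / (κ * y ^ 6) * (Real.log D + p)
      + (a * Real.log y + a + b) * y⁻¹ / ρ
    ≤ ((1 + 2 * a + b) * (Real.log D / p₀ + 1) / κ + (a + (a + b) / p₀) / ρ) / √p₀ *
      ((6 * Real.log y + p) * √p / y) := by
  have hy0 : 0 < y := by linarith
  have hp0 : 0 < p := by linarith
  have hl : 0 ≤ Real.log y := Real.log_nonneg hy
  have hlD : 0 ≤ Real.log D := Real.log_nonneg hD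
  have hly : Real.log y ≤ y := by linarith [Real.log_le_sub_one_of_pos hy0]
  set q := 6 * Real.log y + p with hq
  have hpq : p ≤ q := by linarith
  have hq0 : 0 < q := by linarith
  have h1 : (1 + (a * Real.log y + a + b)) / y⁻¹ ^ 2 / (κ * y ^ 6) * (Real.log D + p)
      ≤ (1 + 2 * a + b) * (Real.log D / p₀ + 1) / κ * (q / y) := by
    have h2 : 1 + (a * Real.log y + a + b) ≤ (1 + 2 * a + b) * y := by nlinarith
    have h3 : Real.log D + p ≤ (Real.log D / p₀ + 1) * q := by
      have : Real.log D ≤ Real.log D / p₀ * q := by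
        rw [div_mul_eq_mul_div, le_div_iff₀ hp₀]
        exact mul_le_mul_of_nonneg_left (hp.trans hpq) hlD
      linarith
    calc (1 + (a * Real.log y + a + b)) / y⁻¹ ^ 2 / (κ * y ^ 6) * (Real.log D + p)
        ≤ (1 + 2 * a + b) * y / y⁻¹ ^ 2 / (κ * y ^ 6) * ((Real.log D / p₀ + 1) * q) := by gcongr
      _ = (1 + 2 * a + b) * (Real.log D / p₀ + 1) / κ * q / y ^ 3 := by field_simp
      _ ≤ (1 + 2 * a + b) * (Real.log D / p₀ + 1) / κ * q / y := by
          gcongr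
          exact le_self_pow₀ hy (by norm_num)
      _ = _ := by ring
  have h2 : (a * Real.log y + a + b) * y⁻¹ / ρ ≤ (a + (a + b) / p₀) / ρ * (q / y) := by
    have h3 : a * Real.log y + a + b ≤ (a + (a + b) / p₀) * q := by
      have h4 : a + b ≤ (a + b) / p₀ * q := by
        rw [div_mul_eq_mul_div, le_div_iff₀ hp₀]
        exact mul_le_mul_of_nonneg_left (hp.trans hpq) (by positivity)
      have h5 : a * Real.log y ≤ a * q := mul_le_mul_of_nonneg_left (by linarith) ha
      linarith
    calc (a * Real.log y + a + b) * y⁻¹ / ρ ≤ (a + (a + b) / p₀) * q * y⁻¹ / ρ := by gcongr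
      _ = _ := by ring
  -- The factor `√p` only weakens the bound; inserting it requires `p` bounded away from `0`, that
  -- is, `δ ≤ δ₀ < 1`.
  have h3 : 1 ≤ √p / √p₀ := (one_le_div (Real.sqrt_pos.2 hp₀)).2 (Real.sqrt_le_sqrt hp)
  set Q := (1 + 2 * a + b) * (Real.log D / p₀ + 1) / κ + (a + (a + b) / p₀) / ρ with hQ
  have hQ0 : 0 ≤ Q := by positivity
  calc _ ≤ Q * (q / y) := by rw [hQ, add_mul _ _ (q / y)]; exact add_le_add h1 h2
    _ ≤ Q * (q / y) * (√p / √p₀) := le_mul_of_one_le_right (by positivity) h3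
    _ = _ := by ring

end

theorem mainTheorem2 (d : ℕ) (ρ G B δ₀ : ℝ) (hρ : 0 < ρ) (hρ1 : ρ ≤ 1) (hG : 0 < G)
    (hB : 0 < B) (hδ₀ : 0 < δ₀) (hδ₀1 : δ₀ < 1) :
    ∃ (C : ℝ) (M₀ : ℕ), 0 < C ∧ 0 < M₀ ∧
      ∀ (L : ℕ) (S : DiffusionSampler d L) (𝒰 : Type*) [MeasurableSpace 𝒰] (ν : Measure 𝒰)
        [IsProbabilityMeasure ν] (A : Set (Vec d × 𝒰)),
        MeasurableSet A → S.Regular ν A ρ G → S.CoeffBounded B →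
        ∀ k : ℕ, k + 1 ≤ L → 0 < S.σ (k + 1) →
        ∀ δ : ℝ, 0 < δ → δ ≤ δ₀ →
        ∀ M : ℕ, M₀ ≤ M →
          ENNReal.ofReal (1 - δ) ≤
            mcLaw d (k + 1) M {z | S.mse ν A k M ((M : ℝ) ^ (-(1 / 6) : ℝ)) z ≤
              ENNReal.ofReal (C * (1 / S.σ (k + 1) ^ 2 *
                (Real.log (M / δ) * √(Real.log (1 / δ)) / (M : ℝ) ^ (1 / 6 : ℝ))))} := by
  obtain ⟨a, b, ha, hb, hV⟩ := exists_norm_integral_smul_sq_le d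
  obtain ⟨κ, D, hκ, hD, hconc⟩ := exists_lintegral_exp_estimator_error_le d
  set p₀ := Real.log (1 / δ₀) with hp₀
  have hp₀pos : 0 < p₀ := Real.log_pos (by rw [lt_div_iff₀ hδ₀]; linarith)
  have hlogD : 0 ≤ Real.log D := Real.log_nonneg hD
  set Q := ((1 + 2 * a + b) * (Real.log D / p₀ + 1) / κ + (a + (a + b) / p₀) / ρ) / √p₀ with hQ
  have hQpos : 0 < Q := by positivity
  -- The `3` comes from squaring a sum of three terms, `B + B * G` bounds the Jacobian of the mean,
  -- and `Q` is the constant of `rate_bound`. No lower bound on `M` beyond `1` is needed.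
  refine ⟨3 * (B + B * G) ^ 2 * Q, 1, by positivity, one_pos, ?_⟩
  intro L S 𝒰 _ ν _ A hA hreg hcoef k hk hσ δ hδ hδδ₀ M hM
  have hS : ∀ l, 1 ≤ l → l ≤ L → Measurable fun x => S.score x (S.t l) := fun l h1 h2 =>
    (hreg.score_differentiable l h1 h2).continuous.measurable
  have hM1 : (1 : ℝ) ≤ M := by exact_mod_cast hM
  have hM0 : (0 : ℝ) < M := by linarith
  have hmean := DiffusionSampler.differentiable_mean hreg.score_differentiable
    (l := k + 1) (by omega) hk
  have hK : ∀ x, ‖fderiv ℝ (S.mean (k + 1)) x‖ ≤ B + B * G := fun x =>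
    DiffusionSampler.norm_fderiv_mean_le (hreg.score_differentiable (k + 1) (by omega) hk x)
      (hreg.score_fderiv_le (k + 1) (by omega) hk x) (hcoef (k + 1) (by omega) hk).1
      (hcoef (k + 1) (by omega) hk).2
  have hVh : ∀ x, 0 < S.doobH ν A (k + 1) x → ‖S.weightedNoise ν A k x‖ ^ 2 ≤
      S.doobH ν A (k + 1) x ^ 2 * (a * -Real.log (S.doobH ν A (k + 1) x) + b) := fun x hx => by
    have hstep := DiffusionSampler.measurable_doobH_step (ν := ν) hA hS hk x
    have h := hV _ hstep (fun _ => DiffusionSampler.doobH_nonneg _ _)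
      (fun _ => DiffusionSampler.doobH_le_one _ _)
    rw [← DiffusionSampler.doobH_succ hA hS hk x] at h
    exact h hx
  have := DiffusionSampler.isProbabilityMeasure_tiltedMarginal (ν := ν) hA hS hk
    (hρ.trans_le hreg.eventProb_ge)
  set y : ℝ := (M : ℝ) ^ (1 / 6 : ℝ) with hy
  have hy1 : 1 ≤ y := Real.one_le_rpow hM1 (by norm_num)
  have hy0 : 0 < y := by linarith
  have hη : (M : ℝ) ^ (-(1 / 6) : ℝ) = y⁻¹ := Real.rpow_neg hM0.le _
  have hMy : (M : ℝ) = y ^ 6 := by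
    rw [hy, ← Real.rpow_natCast, ← Real.rpow_mul hM0.le]; norm_num
  have hp : p₀ ≤ Real.log (1 / δ) :=
    Real.log_le_log (by positivity) (one_div_le_one_div_of_le hδ hδδ₀)
  have hlogM : Real.log (M / δ) = 6 * Real.log y + Real.log (1 / δ) := by
    rw [Real.log_div hM0.ne' hδ.ne', Real.log_div one_ne_zero hδ.ne', Real.log_one, hMy,
      Real.log_pow]
    push_cast; ring
  have hlogDδ : Real.log (D / δ) = Real.log D + Real.log (1 / δ) := by
    rw [← Real.log_mul (by positivity) (by positivity), mul_one_div]
  have hW := DiffusionSampler.measurable_estimator_error (ν := ν) hA hS hk M (κ * M)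
  have hexp := hconc (ν := ν) hA hS hk hM
  -- The tilted marginal does not depend on the Monte Carlo noises, so it can serve as the averaging
  -- measure.
  have hprob := measure_lintegral_le_log_ge (P := mcLaw d (k + 1) M)
    (S.tiltedMarginal ν A (k + 1)) hW (fun x z => by positivity) (by linarith : 0 < D) hδ hexp
  refine hprob.trans (measure_mono fun z hz => ?_)
  rw [Set.mem_ofPred_eq] at hz
  rw [Set.mem_ofPred_eq, hη]
  have hlogy : -Real.log y⁻¹ = Real.log y := by rw [Real.log_inv, neg_neg]
  have hlogy0 : 0 ≤ Real.log y := Real.log_nonneg hy1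
  refine (DiffusionSampler.mse_le hA hS hk hσ hmean hK hρ hreg.eventProb_ge (inv_pos.2 hy0)
    (inv_le_one_of_one_le₀ hy1) ha hb hVh (mul_pos hκ hM0) z).trans ?_
  rw [hlogy]
  refine (mul_le_mul_right (add_le_add_left (mul_le_mul_right hz _) _) _).trans ?_
  have hlogDδ0 : 0 ≤ Real.log D + Real.log (1 / δ) := by linarith
  rw [hlogDδ, ← ENNReal.ofReal_mul (by positivity), ← ENNReal.ofReal_add
    (mul_nonneg (by positivity) hlogDδ0) (by positivity), ← ENNReal.ofReal_mul (by positivity)]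
  refine ENNReal.ofReal_le_ofReal ?_
  have hrate := rate_bound ha hb hκ hD hρ hp₀pos hp hy1
  rw [← hMy] at hrate
  rw [hlogM]
  refine (mul_le_mul_of_nonneg_left hrate (by positivity)).trans (le_of_eq ?_)
  ring
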